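/- Let $0<q<1$, $l>0$, $a=q^{2l-1}$ (so $0<a<q^{-1}$), $0<b<q^{-1}$ and $c<0$. Write $(x;q)_n=\prod_{i=0}^{n-1}(1-xq^i)$, $(x;q)_\infty=\prod_{i\ge 0}(1-xq^i)$, $(x_1,\dots,x_k;q)_n=(x_1;q)_n\cdots(x_k;q)_n$, $[t]_q=\frac{q^{t/2}-q^{-t/2}}{q^{1/2}-q^{-1/2}}$, and let $$P_n(x)=P_n(x;a,b,c;q)={}_3\phi_2(q^{-n},abq^{n+1},x;\,aq,cq;\,q,q)$$ be the big $q$-Jacobi polynomials. On the space of complex polynomials in $x$ let $J_0x^n=(l+n)x^n$, $J_+x^n=[2l+n]_q\,x^{n+1}$, $J_-x^n=[n]_q\,x^{n-1}$, and let $\mathcal H_l$ be the Hilbert space completion in which the monomials $f_n=c_n^l x^n$, $c_n^l=\prod_{k=1}^n([2l+k-1]_q/[k]_q)^{1/2}$, are orthonormal. Let $$I_2=\alpha\,q^{J_0/4}(J_+A+AJ_-)q^{J_0/4}-B,\qquad \alpha=(-ac/q)^{1/2}(1-q),$$ where $A$ and $B$ are diagonal, $Ax^n=A(n)x^n$, $Bx^n=b_nx^n$,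 with $$A(n)=\frac{q^{(n+2)/2}}{1-abq^{2n+2}}\left(\frac{(1-bq^{n+1})(1-abq^{n+1})(1-cq^{n+1})(1-abc^{-1}q^{n+1})}{(1-abq^{2n+1})(1-abq^{2n+3})}\right)^{1/2},$$ $$b_n=\frac{(1-aq^{n+1})(1-abq^{n+1})(1-cq^{n+1})}{(1-abq^{2n+1})(1-abq^{2n+2})}-acq^{n+1}\frac{(1-q^n)(1-bq^n)(1-abc^{-1}q^n)}{(1-abq^{2n})(1-abq^{2n+1})}-1 .$$ Here and below a factor $1-abq$ that occurs in both numerator and denominator is cancelled (this matters only if $abq=1$), and the second term of $b_0$ is $0$. Put $$a_n=\frac{(-acq^{n+2})^{1/2}}{1-abq^{2n+2}}\left(\frac{(1-q^{n+1})(1-aq^{n+1})(1-bq^{n+1})(1-abq^{n+1})(1-cq^{n+1})(1-abc^{-1}q^{n+1})}{(1-abq^{2n+1})(1-abq^{2n+3})}\right)^{1/2},$$ $$\beta_m(\lambda)=\left(\frac{(abq,aq,cq;q)_m(1-abq^{2m+1})}{(abq/c,bq,q;q)_m(1-abq)(-ac)^m}\right)^{1/2}q^{-m(m+3)/4}P_m(\lambda),$$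 $$c_n=\left(\frac{(bq,cq;q)_\infty}{(abq^2,c/a;q)_\infty}\frac{(abq/c,aq;q)_n\,q^n}{(aq/c,q;q)_n}\right)^{1/2},\qquad c'_n=\left(\frac{(aq,abq/c;q)_\infty}{(abq^2,a/c;q)_\infty}\frac{(bq,cq;q)_n\,q^n}{(cq/a,q;q)_n}\right)^{1/2}.$$ Then the following hold. 1. $I_2$ extends uniquely to a bounded operator on $\mathcal H_l$, again denoted $I_2$. It is self-adjoint, of trace class, and a Jacobi operator: $I_2f_n=a_nf_{n+1}+a_{n-1}f_{n-1}-b_nf_n$ with all $a_n>0$ (and no $f_{-1}$ term for $n=0$). 2. The eigenvalues of $I_2$ are exactly the pairwise distinct points $aq^{n+1}$ and $cq^{n+1}$, $n\ge 0$. The spectrum of $I_2$ is $\{aq^{n+1},cq^{n+1}:n\ge0\}\cup\{0\}$, where $0$ is not an eigenvalue and is the only accumulation point of the spectrum. 3. The spectrum is simple: for each $\lambda\in\{aq^{n+1},cq^{n+1}:n\ge 0\}$ the eigenspace is one-dimensional and spanned by $\psi_\lambda=\sum_{m\ge0}\beta_m(\lambda)f_m\in\mathcal H_l$. 4. The vectors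 $c_n\psi_{aq^{n+1}}$ and $c'_n\psi_{cq^{n+1}}$, $n\ge0$, together form an orthonormal basis of $\mathcal H_l$. The real matrix $(\hat a_{mn}\ \hat a'_{mn})$ with $\hat a_{mn}=c_n\beta_m(aq^{n+1})$ and $\hat a'_{mn}=c'_n\beta_m(cq^{n+1})$ is orthogonal: $$\sum_m\hat a_{mn}\hat a_{mn'}=\delta_{nn'},\quad \sum_m\hat a'_{mn}\hat a'_{mn'}=\delta_{nn'},\quad \sum_m\hat a_{mn}\hat a'_{mn'}=0,\quad \sum_n(\hat a_{mn}\hat a_{m'n}+\hat a'_{mn}\hat a'_{m'n})=\delta_{mm'},$$ all series being absolutely convergent. 5. For all $m,m'\ge0$, with both series absolutely convergent, $$\frac{(bq,cq;q)_\infty}{(abq^2,c/a;q)_\infty}\sum_{n=0}^\infty\frac{(aq,abq/c;q)_n\,q^n}{(aq/c,q;q)_n}P_m(aq^{n+1})P_{m'}(aq^{n+1})$$ $$+\frac{(aq,abq/c;q)_\infty}{(abq^2,a/c;q)_\infty}\sum_{n=0}^\infty\frac{(bq,cq;q)_n\,q^n}{(cq/a,q;q)_n}P_m(cq^{n+1})P_{m'}(cq^{n+1})$$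 $$=\frac{(1-abq)(bq,abq/c,q;q)_m}{(1-abq^{2m+1})(aq,abq,cq;q)_m}(-ac)^mq^{m(m+3)/2}\,\delta_{mm'} .$$ -/

import Mathlib

noncomputable section

namespace BigQJacobi

/-- The finite shifted factorial `(x; q)_n = (1 - x)(1 - xq) ⋯ (1 - xq^{n-1})`. -/
def qPoch (q x : ℝ) (n : ℕ) : ℝ := ∏ i ∈ Finset.range n, (1 - x * q ^ i)

/-- The infinite shifted factorial `(x; q)_∞ = ∏_{i ≥ 0} (1 - xq^i)`. -/
def qPochInf (q x : ℝ) : ℝ := ∏' i : ℕ, (1 - x * q ^ i)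

/-- The `q`-number `[t]_q = (q^{t/2} - q^{-t/2}) / (q^{1/2} - q^{-1/2})`. -/
def qNumber (q t : ℝ) : ℝ :=
  (q ^ (t / 2) - q ^ (-t / 2)) / (q ^ (1 / 2 : ℝ) - q ^ (-1 / 2 : ℝ))

/-- The basic hypergeometric series `₃φ₂(u, v, w; d, e; q, z)`. -/
def phi32 (q u v w d e z : ℝ) : ℝ :=
  ∑' k : ℕ, qPoch q u k * qPoch q v k * qPoch q w k /
    (qPoch q d k * qPoch q e k * qPoch q q k) * z ^ k

/-- The big `q`-Jacobi polynomial
`P_n(x; a, b, c; q) = ₃φ₂(q^{-n}, abq^{n+1}, x; aq, cq; q, q)`. -/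
def bigQJacobi (q a b c : ℝ) (n : ℕ) (x : ℝ) : ℝ :=
  phi32 q ((q ^ n)⁻¹) (a * b * q ^ (n + 1)) x (a * q) (c * q) q

/-! ### The discrete series representation with lowest weight `l`

The representation space is the space of polynomials in `x`, with `J₀ xⁿ = (l + n) xⁿ`. -/

/-- The diagonal operator `φ(J₀ - l)`, that is, `xⁿ ↦ φ(n) xⁿ`. -/
def diagOp (φ : ℕ → ℝ) : Polynomial ℂ →ₗ[ℂ] Polynomial ℂ :=
  (Polynomial.basisMonomials ℂ).constr ℂ fun n => Polynomial.monomial n (φ n : ℂ)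

/-- The operator `q^{J₀/4}`. -/
def qJ4 (q l : ℝ) : Polynomial ℂ →ₗ[ℂ] Polynomial ℂ :=
  diagOp fun n => q ^ ((l + n) / 4)

/-- The raising operator `J₊ = x [J₀ + l]_q`. -/
def Jplus (q l : ℝ) : Polynomial ℂ →ₗ[ℂ] Polynomial ℂ :=
  (Polynomial.basisMonomials ℂ).constr ℂ fun n =>
    Polynomial.monomial (n + 1) (qNumber q (2 * l + n) : ℂ)

/-- The lowering operator `J₋ = x⁻¹ [J₀ - l]_q`; it annihilates constants because `[0]_q = 0`. -/
def Jminus (q : ℝ) : Polynomial ℂ →ₗ[ℂ] Polynomial ℂ :=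
  (Polynomial.basisMonomials ℂ).constr ℂ fun n =>
    Polynomial.monomial (n - 1) (qNumber q n : ℂ)

/-- The quotient `(1 - abq^{n+1}) / (1 - abq^{2n+1})`. Its numerator and denominator coincide for
`n = 0`, where it is read as `1` (this matters only if `abq = 1`). -/
def abRatio (q a b : ℝ) (n : ℕ) : ℝ :=
  if n = 0 then 1 else (1 - a * b * q ^ (n + 1)) / (1 - a * b * q ^ (2 * n + 1))

theorem abRatio_eq (q a b : ℝ) (h : a * b * q ≠ 1) (n : ℕ) :
    abRatio q a b n = (1 - a * b * q ^ (n + 1)) / (1 - a * b * q ^ (2 * n + 1)) := by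
  unfold abRatio
  split_ifs with hn
  · subst hn
    have h1 : 1 - a * b * q ≠ 0 := sub_ne_zero.mpr (Ne.symm h)
    simp [div_self h1]
  · rfl

/-- The eigenvalue of the diagonal operator `A` on `xⁿ`. All square roots are collected into one,
because numerator and denominator of the radicand are both negative for `n = 0`, `abq > 1`. -/
def coeffA (q a b c : ℝ) (n : ℕ) : ℝ :=
  q ^ (((n : ℝ) + 2) / 2) *
    Real.sqrt ((1 - b * q ^ (n + 1)) * (1 - c * q ^ (n + 1)) * (1 - a * b / c * q ^ (n + 1)) *
      abRatio q a b n / (1 - a * b * q ^ (2 * n + 3))) /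
    (1 - a * b * q ^ (2 * n + 2))

/-- The eigenvalue of the diagonal operator `B` on `xⁿ`. -/
def coeffB (q a b c : ℝ) (n : ℕ) : ℝ :=
  (1 - a * q ^ (n + 1)) * (1 - c * q ^ (n + 1)) * abRatio q a b n /
      (1 - a * b * q ^ (2 * n + 2)) -
    a * c * q ^ (n + 1) * ((1 - q ^ n) * (1 - b * q ^ n) * (1 - a * b / c * q ^ n) /
      ((1 - a * b * q ^ (2 * n)) * (1 - a * b * q ^ (2 * n + 1)))) - 1

/-- The operator `I₂ = α q^{J₀/4} (J₊ A + A J₋) q^{J₀/4} - B` on the space of polynomials, where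
`a = q^{2l-1}` and `α = (-ac/q)^{1/2} (1 - q)`. -/
def I2 (q l b c : ℝ) : Polynomial ℂ →ₗ[ℂ] Polynomial ℂ :=
  let a : ℝ := q ^ (2 * l - 1)
  let A := diagOp (coeffA q a b c)
  let B := diagOp (coeffB q a b c)
  ((Real.sqrt (-a * c / q) * (1 - q) : ℝ) : ℂ) •
    (qJ4 q l ∘ₗ (Jplus q l ∘ₗ A + A ∘ₗ Jminus q) ∘ₗ qJ4 q l) - B

/-- The norming constants `c_n^l = ∏_{k=1}^n ([2l+k-1]_q / [k]_q)^{1/2}`. -/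
def basisConst (q l : ℝ) (n : ℕ) : ℝ :=
  ∏ k ∈ Finset.Icc 1 n, Real.sqrt (qNumber q (2 * l + k - 1)) / Real.sqrt (qNumber q k)

/-- The Hilbert space `H_l`, the completion of the space of polynomials for the scalar product in
which the monomials `f_n = c_n^l xⁿ` are orthonormal. The element `∑ β_n f_n` is represented by
the square-summable sequence `(β_n)`. -/
abbrev HilbertSp : Type := lp (fun _ : ℕ => ℂ) 2

/-- The basis element `f_n` of `H_l`. -/
def basisVec (n : ℕ) : HilbertSp := lp.single 2 n (1 : ℂ)

/-- The inclusion of the space of polynomials into `H_l`, which sends `c_n^l xⁿ` to `f_n`. -/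
def toHilbert (q l : ℝ) : Polynomial ℂ →ₗ[ℂ] HilbertSp :=
  (Polynomial.basisMonomials ℂ).constr ℂ fun n => ((basisConst q l n : ℂ))⁻¹ • basisVec n

/-- A bounded operator `T` extends the operator `S` given on polynomials. -/
def Extends (q l : ℝ) (T : HilbertSp →L[ℂ] HilbertSp)
    (S : Polynomial ℂ →ₗ[ℂ] Polynomial ℂ) : Prop :=
  ∀ p : Polynomial ℂ, T (toHilbert q l p) = toHilbert q l (S p)

/-- Trace class: `∑ ⟨e_n, |T| e_n⟩ < ∞` for an orthonormal basis `e`, where `|T|` is the positive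
square root of `T* T`, that is, the unique positive operator `R` with `R² = T* T`. -/
def IsTraceClass (T : HilbertSp →L[ℂ] HilbertSp) : Prop :=
  ∃ R : HilbertSp →L[ℂ] HilbertSp, R.IsPositive ∧ R ∘L R = ContinuousLinearMap.adjoint T ∘L T ∧
    ∃ e : HilbertBasis ℕ ℂ HilbertSp, Summable fun n : ℕ => (inner ℂ (e n) (R (e n))).re

/-- The off-diagonal entries `a_n` of the Jacobi matrix of `I₂`. -/
def jacobiOff (q a b c : ℝ) (n : ℕ) : ℝ :=
  Real.sqrt (-a * c * q ^ (n + 2)) *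
    Real.sqrt ((1 - q ^ (n + 1)) * (1 - a * q ^ (n + 1)) * (1 - b * q ^ (n + 1)) *
      (1 - c * q ^ (n + 1)) * (1 - a * b / c * q ^ (n + 1)) *
      abRatio q a b n / (1 - a * b * q ^ (2 * n + 3))) /
    (1 - a * b * q ^ (2 * n + 2))

/-- The quotient `(abq; q)_m (1 - abq^{2m+1}) / (1 - abq)` with the common factor `1 - abq`
cancelled. -/
def abWeight (q a b : ℝ) (m : ℕ) : ℝ :=
  if m = 0 then 1 else qPoch q (a * b * q ^ 2) (m - 1) * (1 - a * b * q ^ (2 * m + 1))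

theorem abWeight_eq (q a b : ℝ) (h : a * b * q ≠ 1) (m : ℕ) :
    abWeight q a b m =
      qPoch q (a * b * q) m * (1 - a * b * q ^ (2 * m + 1)) / (1 - a * b * q) := by
  have h1 : 1 - a * b * q ≠ 0 := sub_ne_zero.mpr (Ne.symm h)
  unfold abWeight
  rcases m with _ | m
  · simp [qPoch, div_self h1]
  · have h2 : qPoch q (a * b * q) (m + 1) = qPoch q (a * b * q ^ 2) m * (1 - a * b * q) := by
      unfold qPoch
      rw [Finset.prod_range_succ']
      simp only [pow_zero, mul_one]
      congr 1
      refine Finset.prod_congr rfl fun i _ => ?_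
      ring
    rw [if_neg (Nat.succ_ne_zero m), h2, eq_div_iff h1]
    simp only [Nat.add_sub_cancel]
    ring

/-- The coefficients `β_m(x)` of the (generalized) eigenvector `ψ_x = ∑ β_m(x) f_m`:
`((abq, aq, cq; q)_m (1 - abq^{2m+1}) / ((abq/c, bq, q; q)_m (1 - abq) (-ac)^m))^{1/2}
q^{-m(m+3)/4} P_m(x; a, b, c; q)`. -/
def beta (q a b c : ℝ) (m : ℕ) (x : ℝ) : ℝ :=
  Real.sqrt (abWeight q a b m * qPoch q (a * q) m * qPoch q (c * q) m /
      (qPoch q (a * b * q / c) m * qPoch q (b * q) m * qPoch q q m * (-a * c) ^ m)) *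
    q ^ (-((m : ℝ) * (m + 3)) / 4) * bigQJacobi q a b c m x

/-- The constant `C² = (bq, cq; q)_∞ / (abq², c/a; q)_∞`. -/
def constC (q a b c : ℝ) : ℝ :=
  qPochInf q (b * q) * qPochInf q (c * q) / (qPochInf q (a * b * q ^ 2) * qPochInf q (c / a))

/-- The constant `C'² = (aq, abq/c; q)_∞ / (abq², a/c; q)_∞`. -/
def constC' (q a b c : ℝ) : ℝ :=
  qPochInf q (a * q) * qPochInf q (a * b * q / c) /
    (qPochInf q (a * b * q ^ 2) * qPochInf q (a / c))

/-- `(aq, abq/c; q)_n q^n / (aq/c, q; q)_n`. -/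
def weight (q a b c : ℝ) (n : ℕ) : ℝ :=
  qPoch q (a * q) n * qPoch q (a * b * q / c) n * q ^ n / (qPoch q (a * q / c) n * qPoch q q n)

/-- `(bq, cq; q)_n q^n / (cq/a, q; q)_n`. -/
def weight' (q a b c : ℝ) (n : ℕ) : ℝ :=
  qPoch q (b * q) n * qPoch q (c * q) n * q ^ n / (qPoch q (c * q / a) n * qPoch q q n)

/-- The points `aq^{n+1}` (left summand) and `cq^{n+1}` (right summand). -/
def node (q a c : ℝ) : ℕ ⊕ ℕ → ℝ :=
  Sum.elim (fun n => a * q ^ (n + 1)) (fun n => c * q ^ (n + 1))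

/-- The normalizing factors: `c_n` (left summand) and `c'_n` (right summand). -/
def normFactor (q a b c : ℝ) : ℕ ⊕ ℕ → ℝ :=
  Sum.elim (fun n => Real.sqrt (constC q a b c * weight q a b c n))
    (fun n => Real.sqrt (constC' q a b c * weight' q a b c n))

/-- The matrix `(â_{mn}  â'_{mn})`, with `â_{mn} = c_n β_m(aq^{n+1})` in the left block of columns
and `â'_{mn} = c'_n β_m(cq^{n+1})` in the right block. -/
def Mhat (q a b c : ℝ) : Matrix ℕ (ℕ ⊕ ℕ) ℝ :=
  fun m k => normFactor q a b c k * beta q a b c m (node q a c k)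

end BigQJacobi

end

noncomputable section

namespace BigQJacobi

open Filter Topology

/-! ### Shifted factorials -/

/-! The operator is diagonalized backwards. Instead of extending $I_2$ and then computing its
spectrum, the proof builds an orthonormal basis from the polynomials, defines $T$ as multiplication
by the nodes $aq^{n+1}$, $cq^{n+1}$ in that basis, and checks that $T$ acts on the $f_n$ as the
Jacobi matrix. Boundedness, self-adjointness, trace class, spectrum and eigenspaces are then facts
about a diagonal operator whose entries are distinct, nonzero and absolutely summable.

The basis comes from orthogonality with respect to a discrete measure on the nodes. Up to
normalization its mass at $x$ is $|x|\,w(x)$ with $w(x)=(x/a,x/c;q)_\infty/(x,bx/c;q)_\infty$. Since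
$(x;q)_j/(x;q)_\infty=1/(xq^j;q)_\infty$, the integral of $(x;q)_j$ is again a $q$-beta integral.
These integrals satisfy a first-order functional equation obtained by telescoping (`qBeta_shift`),
which reduces them to one constant; that constant is found from the case where the integrand is $1$
(`qBeta_zero_zero`). A balanced summation (`sum_range_qPoch_balanced`) then shows that $P_n$
integrates to $0$ for $n\ge1$.

Full orthogonality follows from the three-term recurrence alone (`bigQJacobi_recurrence_succ`):
multiplication by $x$ can be moved from $P_m$ to $P_n$, so the products $P_mP_n$ reduce by induction
on $m$ to the row $m=0$ (`hasSum_bigQJacobi_mul`). Dividing by the norms makes the recurrence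
symmetric, with off-diagonal entries $a_n$ and diagonal entries $-b_n$.

The rows of `Mhat` are therefore orthonormal. They are complete because a summable signed or complex
measure on distinct points of a bounded interval is determined by its moments
(`eq_zero_of_moments`). Hence `Mhat` defines a unitary map, and its columns are the Hilbert basis
$\Psi$ (`exists_hilbertBasis`). In the coordinates of $\Psi$ the vector $f_m$ is row $m$, so the
recurrence evaluated at the nodes is exactly the Jacobi action of $T$. Finally
`matrixFactor_mul_sqrt` identifies this Jacobi matrix with $I_2$ on polynomials. -/

theorem qPoch_zero (q x : ℝ) : qPoch q x 0 = 1 := by simp [qPoch]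

theorem qPoch_succ (q x : ℝ) (n : ℕ) : qPoch q x (n + 1) = qPoch q x n * (1 - x * q ^ n) :=
  Finset.prod_range_succ _ _

theorem qPoch_succ_left (q x : ℝ) (n : ℕ) :
    qPoch q x (n + 1) = (1 - x) * qPoch q (x * q) n := by
  unfold qPoch
  rw [Finset.prod_range_succ', mul_comm]
  congr 1
  · simp
  · exact Finset.prod_congr rfl fun i _ => by ring

theorem qPoch_pos {q x : ℝ} (hq0 : 0 < q) (hq1 : q < 1) (hx : x < 1) (n : ℕ) :
    0 < qPoch q x n := by
  refine Finset.prod_pos fun i _ => ?_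
  have h1 : q ^ i ≤ 1 := pow_le_one₀ hq0.le hq1.le
  have h2 : 0 < q ^ i := pow_pos hq0 i
  rcases le_or_gt x 0 with h | h
  · nlinarith
  · nlinarith

theorem summable_mul_pow {q : ℝ} (hq0 : 0 < q) (hq1 : q < 1) (x : ℝ) :
    Summable fun i : ℕ => x * q ^ i :=
  (summable_geometric_of_lt_one hq0.le hq1).mul_left x

theorem multipliable_qPochInf {q : ℝ} (hq0 : 0 < q) (hq1 : q < 1) (x : ℝ) :
    Multipliable fun i : ℕ => 1 - x * q ^ i := by
  simpa [sub_eq_add_neg] using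
    Real.multipliable_one_add_of_summable (summable_mul_pow hq0 hq1 x).neg

theorem tendsto_qPoch {q : ℝ} (hq0 : 0 < q) (hq1 : q < 1) (x : ℝ) :
    Tendsto (qPoch q x) atTop (𝓝 (qPochInf q x)) :=
  (multipliable_qPochInf hq0 hq1 x).hasProd.tendsto_prod_nat

theorem qPochInf_zero (q : ℝ) : qPochInf q 0 = 1 := by simp [qPochInf]

theorem qPochInf_eq {q : ℝ} (hq0 : 0 < q) (hq1 : q < 1) (x : ℝ) :
    qPochInf q x = (1 - x) * qPochInf q (x * q) := by
  have h1 := (tendsto_qPoch hq0 hq1 x).comp (tendsto_add_atTop_nat 1)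
  have h2 := (tendsto_qPoch hq0 hq1 (x * q)).const_mul (1 - x)
  refine tendsto_nhds_unique h1 (h2.congr fun n => ?_)
  exact (qPoch_succ_left q x n).symm

theorem qPochInf_eq_mul {q : ℝ} (hq0 : 0 < q) (hq1 : q < 1) (x : ℝ) (n : ℕ) :
    qPochInf q x = qPoch q x n * qPochInf q (x * q ^ n) := by
  induction n with
  | zero => simp [qPoch_zero]
  | succ n ih =>
    rw [ih, qPoch_succ, qPochInf_eq hq0 hq1 (x * q ^ n), pow_succ]
    ring_nf

theorem qPochInf_one {q : ℝ} (hq0 : 0 < q) (hq1 : q < 1) : qPochInf q 1 = 0 := by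
  rw [qPochInf_eq hq0 hq1]; simp

/-- The limit of positive partial products is nonnegative. It is nonzero because an absolutely
convergent product without a zero factor does not vanish. -/
theorem qPochInf_pos {q x : ℝ} (hq0 : 0 < q) (hq1 : q < 1) (hx : x < 1) :
    0 < qPochInf q x := by
  refine lt_of_le_of_ne (ge_of_tendsto' (tendsto_qPoch hq0 hq1 x)
    fun n => (qPoch_pos hq0 hq1 hx n).le) (Ne.symm ?_)
  have h := tprod_one_add_ne_zero_of_summable (f := fun i : ℕ => -(x * q ^ i)) (fun i => ?_)
    (summable_mul_pow hq0 hq1 x).neg.norm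
  · simpa [qPochInf, sub_eq_add_neg] using h
  · have h1 := qPoch_pos hq0 hq1 hx (i + 1)
    rw [qPoch_succ] at h1
    intro h2
    rw [sub_eq_add_neg, h2] at h1
    simp at h1

theorem qPochInf_anti {q x y : ℝ} (hq0 : 0 < q) (hq1 : q < 1) (hxy : x ≤ y) (hy : y ≤ 1) :
    qPochInf q y ≤ qPochInf q x := by
  refine le_of_tendsto_of_tendsto' (tendsto_qPoch hq0 hq1 y) (tendsto_qPoch hq0 hq1 x) fun n => ?_
  refine Finset.prod_le_prod (fun i _ => ?_) fun i _ => ?_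
  · have h1 : q ^ i ≤ 1 := pow_le_one₀ hq0.le hq1.le
    have h2 : 0 < q ^ i := pow_pos hq0 i
    nlinarith
  · have h2 : 0 < q ^ i := pow_pos hq0 i
    nlinarith

theorem tendsto_mul_pow {q : ℝ} (hq0 : 0 < q) (hq1 : q < 1) (x : ℝ) :
    Tendsto (fun n : ℕ => x * q ^ n) atTop (𝓝 0) := by
  simpa using (tendsto_pow_atTop_nhds_zero_of_lt_one hq0.le hq1).const_mul x

theorem tendsto_qPochInf_mul_pow {q : ℝ} (hq0 : 0 < q) (hq1 : q < 1) (x : ℝ) :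
    Tendsto (fun n : ℕ => qPochInf q (x * q ^ n)) atTop (𝓝 1) := by
  -- Nothing bounds $x$, so some factors may vanish. Past an index with $xq^N<1$ they are positive,
  -- and the tail product is a quotient of the full product by a partial one.
  obtain ⟨N, hN⟩ := ((tendsto_mul_pow hq0 hq1 x).eventually_lt_const one_pos).exists
  rw [← tendsto_add_atTop_iff_nat N]
  have h0 := qPochInf_pos hq0 hq1 hN
  have h := (tendsto_const_nhds (x := qPochInf q (x * q ^ N))).div
    (tendsto_qPoch hq0 hq1 (x * q ^ N)) h0.ne'
  rw [div_self h0.ne'] at h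
  refine h.congr fun n => ?_
  rw [Pi.div_apply, qPochInf_eq_mul hq0 hq1 _ n, mul_div_cancel_left₀ _ (qPoch_pos hq0 hq1 hN n).ne']
  ring_nf

/-! ### A `q`-beta integral -/

/-- The parameters for which the `q`-beta integral below is treated. -/
structure Adm (q a c s : ℝ) : Prop where
  lt_left : s * (a * q) < 1
  lt_right : s * (c * q) < 1

/-- The integrand `(x/a, x/c; q)_∞ / (sx, dx; q)_∞`. -/
def qBetaWeight (q a c s d x : ℝ) : ℝ :=
  qPochInf q (x / a) * qPochInf q (x / c) / (qPochInf q (s * x) * qPochInf q (d * x))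

/-- The `q`-integral of `(x/a, x/c; q)_∞ / (sx, dx; q)_∞` over `[cq, aq]`, up to the
factor `1 - q`. -/
def qBeta (q a c s d : ℝ) : ℝ :=
  ∑' k, |node q a c k| * qBetaWeight q a c s d (node q a c k)

variable {q a c : ℝ}

theorem node_mem (hq0 : 0 < q) (hq1 : q < 1) (ha : 0 < a) (hc : c < 0) (k : ℕ ⊕ ℕ) :
    node q a c k ∈ Set.Icc (c * q) (a * q) := by
  rcases k with n | n
  · have h1 : q ^ n ≤ 1 := pow_le_one₀ hq0.le hq1.le
    have h2 : 0 < q ^ n := pow_pos hq0 n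
    have h3 : 0 < a * q := mul_pos ha hq0
    have h4 : c * q < 0 := mul_neg_of_neg_of_pos hc hq0
    simp only [node, Sum.elim_inl, Set.mem_Icc, pow_succ]
    constructor <;> nlinarith
  · have h1 : q ^ n ≤ 1 := pow_le_one₀ hq0.le hq1.le
    have h2 : 0 < q ^ n := pow_pos hq0 n
    have h3 : 0 < a * q := mul_pos ha hq0
    have h4 : c * q < 0 := mul_neg_of_neg_of_pos hc hq0
    simp only [node, Sum.elim_inr, Set.mem_Icc, pow_succ]
    constructor <;> nlinarith

theorem node_inl_pos (hq0 : 0 < q) (ha : 0 < a) (n : ℕ) : 0 < node q a c (Sum.inl n) :=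
  mul_pos ha (pow_pos hq0 _)

theorem node_inr_neg (hq0 : 0 < q) (hc : c < 0) (n : ℕ) : node q a c (Sum.inr n) < 0 :=
  mul_neg_of_neg_of_pos hc (pow_pos hq0 _)

theorem summable_abs_node (hq0 : 0 < q) (hq1 : q < 1) :
    Summable fun k => |node q a c k| := by
  have h (x : ℝ) : Summable fun n : ℕ => |x * q ^ (n + 1)| := by
    have h1 := (summable_mul_pow hq0 hq1 (x * q)).abs
    refine h1.congr fun n => ?_
    ring_nf
  exact (h a).sum (f := fun k => |node q a c k|) (h c)

theorem mul_le_max {s x : ℝ} (hx : x ∈ Set.Icc (c * q) (a * q)) :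
    s * x ≤ max (s * (a * q)) (s * (c * q)) := by
  rcases le_total 0 s with hs | hs
  · exact le_max_of_le_left (mul_le_mul_of_nonneg_left hx.2 hs)
  · exact le_max_of_le_right (mul_le_mul_of_nonpos_left hx.1 hs)

/-- The function $x\mapsto sx$ is linear, so the two endpoint conditions control the whole interval.
They keep every denominator $(sx;q)_\infty$ positive there. -/
theorem Adm.mul_lt_one {s x : ℝ} (h : Adm q a c s) (hx : x ∈ Set.Icc (c * q) (a * q)) :
    s * x < 1 := (mul_le_max hx).trans_lt (max_lt h.1 h.2)

theorem Adm.zero : Adm q a c 0 := ⟨by simp, by simp⟩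

theorem Adm.mul_pow {s : ℝ} (hq0 : 0 < q) (hq1 : q < 1) (h : Adm q a c s) (n : ℕ) :
    Adm q a c (s * q ^ n) := by
  have h1 : q ^ n ≤ 1 := pow_le_one₀ hq0.le hq1.le
  have h2 : 0 < q ^ n := pow_pos hq0 n
  have key (y : ℝ) (hy : s * y < 1) : s * q ^ n * y < 1 := by
    rcases le_total (s * y) 0 with h0 | h0 <;> nlinarith
  exact ⟨key _ h.1, key _ h.2⟩

theorem adm_inv_left (hq0 : 0 < q) (hq1 : q < 1) (ha : 0 < a) (hc : c < 0) :
    Adm q a c (1 / a) := by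
  constructor
  · rw [one_div, inv_mul_cancel_left₀ ha.ne']; exact hq1
  · refine lt_of_le_of_lt ?_ one_pos
    exact mul_nonpos_of_nonneg_of_nonpos (by positivity) (mul_neg_of_neg_of_pos hc hq0).le

theorem adm_inv_right (hq0 : 0 < q) (hq1 : q < 1) (ha : 0 < a) (hc : c < 0) :
    Adm q a c (1 / c) := by
  constructor
  · refine lt_of_le_of_lt ?_ one_pos
    exact mul_nonpos_of_nonpos_of_nonneg (one_div_neg.mpr hc).le (by positivity)
  · rw [one_div, inv_mul_cancel_left₀ hc.ne]; exact hq1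

/-- The bound must not depend on $t$, which will be $q^n\to0$. The maximum with $0$ covers negative
$sx$, where shrinking $t$ moves $stx$ up towards $0$. -/
theorem qPochInf_mul_ge {s t x : ℝ} (hq0 : 0 < q) (hq1 : q < 1) (h : Adm q a c s)
    (ht0 : 0 ≤ t) (ht1 : t ≤ 1) (hx : x ∈ Set.Icc (c * q) (a * q)) :
    qPochInf q (max 0 (max (s * (a * q)) (s * (c * q)))) ≤ qPochInf q (s * t * x) := by
  refine qPochInf_anti hq0 hq1 ?_ (max_le zero_le_one (max_le h.1.le h.2.le))
  have h1 := mul_le_max (s := s) hx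
  rcases le_total (s * x) 0 with h0 | h0
  · exact le_max_of_le_left (by nlinarith)
  · refine le_max_of_le_right (le_trans ?_ h1)
    nlinarith

/-- A bound for the integrand on `[cq, aq]`. -/
def qBetaBound (q a c s d : ℝ) : ℝ :=
  qPochInf q (c * q / a) * qPochInf q (a * q / c) /
    (qPochInf q (max 0 (max (s * (a * q)) (s * (c * q)))) *
      qPochInf q (max 0 (max (d * (a * q)) (d * (c * q)))))

theorem qBetaWeight_pos (hq0 : 0 < q) (hq1 : q < 1) (ha : 0 < a) (hc : c < 0) {s d x : ℝ}
    (hs : Adm q a c s) (hd : Adm q a c d) (hx : x ∈ Set.Icc (c * q) (a * q)) :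
    0 < qBetaWeight q a c s d x := by
  have h1 := (adm_inv_left hq0 hq1 ha hc).mul_lt_one hx
  have h2 := (adm_inv_right hq0 hq1 ha hc).mul_lt_one hx
  rw [one_div_mul_eq_div] at h1 h2
  exact div_pos (mul_pos (qPochInf_pos hq0 hq1 h1) (qPochInf_pos hq0 hq1 h2))
    (mul_pos (qPochInf_pos hq0 hq1 (hs.mul_lt_one hx)) (qPochInf_pos hq0 hq1 (hd.mul_lt_one hx)))

theorem qBetaWeight_le (hq0 : 0 < q) (hq1 : q < 1) (ha : 0 < a) (hc : c < 0) {s d t x : ℝ}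
    (hs : Adm q a c s) (hd : Adm q a c d) (ht0 : 0 ≤ t) (ht1 : t ≤ 1)
    (hx : x ∈ Set.Icc (c * q) (a * q)) :
    qBetaWeight q a c (s * t) d x ≤ qBetaBound q a c s d := by
  have h1 := (adm_inv_left hq0 hq1 ha hc).mul_lt_one hx
  have h2 := (adm_inv_right hq0 hq1 ha hc).mul_lt_one hx
  rw [one_div_mul_eq_div] at h1 h2
  have hs' := qPochInf_mul_ge hq0 hq1 hs ht0 ht1 hx
  have hd' := qPochInf_mul_ge hq0 hq1 hd zero_le_one le_rfl hx
  rw [mul_one] at hd'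
  have p1 := qPochInf_pos hq0 hq1 (max_lt one_pos (max_lt hs.1 hs.2))
  have p2 := qPochInf_pos hq0 hq1 (max_lt one_pos (max_lt hd.1 hd.2))
  have e1 : c * q / a ≤ x / a := by gcongr; exact hx.1
  have e2 : a * q / c ≤ x / c := div_le_div_of_nonpos_of_le hc.le hx.2
  have n1 := qPochInf_anti hq0 hq1 e1 h1.le
  have n2 := qPochInf_anti hq0 hq1 e2 h2.le
  have n3 := qPochInf_pos hq0 hq1 h1
  have n4 := qPochInf_pos hq0 hq1 h2
  exact div_le_div₀ (mul_nonneg (n3.le.trans n1) (n4.le.trans n2))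
    (mul_le_mul n1 n2 n4.le (n3.le.trans n1)) (mul_pos p1 p2)
    (mul_le_mul hs' hd' p2.le (p1.le.trans hs'))

theorem summable_qBeta (hq0 : 0 < q) (hq1 : q < 1) (ha : 0 < a) (hc : c < 0) {s d : ℝ}
    (hs : Adm q a c s) (hd : Adm q a c d) :
    Summable fun k => |node q a c k| * qBetaWeight q a c s d (node q a c k) := by
  refine Summable.of_nonneg_of_le (fun k => ?_) (fun k => ?_)
    ((summable_abs_node hq0 hq1 (a := a) (c := c)).mul_right (qBetaBound q a c s d))
  · exact mul_nonneg (abs_nonneg _)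
      (qBetaWeight_pos hq0 hq1 ha hc hs hd (node_mem hq0 hq1 ha hc k)).le
  · have h := qBetaWeight_le hq0 hq1 ha hc hs hd zero_le_one le_rfl (node_mem hq0 hq1 ha hc k)
    rw [mul_one] at h
    exact mul_le_mul_of_nonneg_left h (abs_nonneg _)

theorem tendsto_qBeta (hq0 : 0 < q) (hq1 : q < 1) (ha : 0 < a) (hc : c < 0) {s d : ℝ}
    (hs : Adm q a c s) (hd : Adm q a c d) :
    Tendsto (fun n : ℕ => qBeta q a c (s * q ^ n) d) atTop (𝓝 (qBeta q a c 0 d)) := by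
  refine tendsto_tsum_of_dominated_convergence
    ((summable_abs_node hq0 hq1 (a := a) (c := c)).mul_right (qBetaBound q a c s d))
    (fun k => ?_) (Eventually.of_forall fun n k => ?_)
  · refine Tendsto.const_mul _ ?_
    unfold qBetaWeight
    rw [zero_mul, qPochInf_zero]
    have hp := qPochInf_pos hq0 hq1 (hd.mul_lt_one (node_mem hq0 hq1 ha hc k))
    refine Tendsto.div tendsto_const_nhds ?_ (by simpa using hp.ne')
    refine Tendsto.mul_const _ ?_
    refine (tendsto_qPochInf_mul_pow hq0 hq1 (s * node q a c k)).congr fun n => ?_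
    ring_nf
  · have hx := node_mem hq0 hq1 ha hc k
    have h0 := qBetaWeight_pos hq0 hq1 ha hc (hs.mul_pow hq0 hq1 n) hd hx
    rw [Real.norm_of_nonneg (mul_nonneg (abs_nonneg _) h0.le)]
    exact mul_le_mul_of_nonneg_left (qBetaWeight_le hq0 hq1 ha hc hs hd (pow_pos hq0 n).le
      (pow_le_one₀ hq0.le hq1.le) hx) (abs_nonneg _)

theorem tsum_sub_succ {f : ℕ → ℝ} {l : ℝ} (hf : Tendsto f atTop (𝓝 l))
    (hs : Summable fun n => f n - f (n + 1)) : ∑' n, (f n - f (n + 1)) = f 0 - l := by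
  refine tendsto_nhds_unique hs.hasSum.tendsto_sum_nat ?_
  simp_rw [Finset.sum_range_sub']
  exact tendsto_const_nhds.sub hf

/-- The integrands with parameters $s$ and $sq$ combine to a $q$-difference. Its primitive is the
same expression with $a,c$ replaced by $aq,cq$, which vanishes at the endpoints $aq$ and $cq$. -/
theorem qBetaWeight_shift (hq0 : 0 < q) (hq1 : q < 1) (ha : 0 < a) (hc : c < 0) {s d x : ℝ}
    (hs : Adm q a c s) (hd : Adm q a c d) (hx : x ∈ Set.Icc (c * q) (a * q)) :
    x * ((1 - s * (a * q)) * (1 - s * (c * q)) * qBetaWeight q a c s d x -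
        (1 - a * c * q ^ 2 * s * d) * qBetaWeight q a c (s * q) d x) =
      a * c * q ^ 2 * s * (qBetaWeight q (a * q) (c * q) s d x -
        qBetaWeight q (a * q) (c * q) s d (x * q)) := by
  have e1 := qPochInf_eq hq0 hq1 (x / (a * q))
  have e2 := qPochInf_eq hq0 hq1 (x / (c * q))
  have e3 := qPochInf_eq hq0 hq1 (s * x)
  have e4 := qPochInf_eq hq0 hq1 (d * x)
  have p3 := qPochInf_pos hq0 hq1 (hs.mul_lt_one hx)
  have p4 := qPochInf_pos hq0 hq1 (hd.mul_lt_one hx)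
  have q0 := hq0.ne'
  have a0 := ha.ne'
  have c0 := hc.ne
  have i1 : x / (a * q) * q = x / a := by field_simp
  have i2 : x / (c * q) * q = x / c := by field_simp
  have i3 : x * q / (a * q) = x / a := by field_simp
  have i4 : x * q / (c * q) = x / c := by field_simp
  have i5 : s * (x * q) = s * x * q := by ring
  have i6 : d * (x * q) = d * x * q := by ring
  have i7 : s * q * x = s * x * q := by ring
  rw [i1] at e1
  rw [i2] at e2
  unfold qBetaWeight
  rw [i3, i4, i5, i6, i7, e1, e2, e3, e4]
  rw [e3] at p3
  rw [e4] at p4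
  have n1 := left_ne_zero_of_mul p3.ne'
  have n2 := right_ne_zero_of_mul p3.ne'
  have n3 := left_ne_zero_of_mul p4.ne'
  have n4 := right_ne_zero_of_mul p4.ne'
  generalize qPochInf q (s * x * q) = S at *
  generalize qPochInf q (d * x * q) = D at *
  generalize qPochInf q (x / a) = U at *
  generalize qPochInf q (x / c) = V at *
  -- The factors $1-sx$ and $1-dx$ become atoms, so that clearing denominators leaves a polynomial
  -- identity.
  obtain ⟨X, hX⟩ : ∃ X, X = 1 - s * x := ⟨_, rfl⟩
  obtain ⟨Y, hY⟩ : ∃ Y, Y = 1 - d * x := ⟨_, rfl⟩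
  rw [← hX] at n1 ⊢
  rw [← hY] at n3 ⊢
  field_simp
  rw [hX, hY]
  ring

theorem tendsto_qBetaWeight_mul_pow (hq0 : 0 < q) (hq1 : q < 1) (a c s d x : ℝ) :
    Tendsto (fun n : ℕ => qBetaWeight q a c s d (x * q ^ n)) atTop (𝓝 1) := by
  have h (y : ℝ) : Tendsto (fun n : ℕ => qPochInf q (y * (x * q ^ n))) atTop (𝓝 1) := by
    simpa only [mul_assoc] using tendsto_qPochInf_mul_pow hq0 hq1 (y * x)
  have := ((h a⁻¹).mul (h c⁻¹)).div ((h s).mul (h d)) (by simp)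
  simp only [mul_one, div_one] at this
  refine this.congr fun n => ?_
  simp [qBetaWeight, div_eq_inv_mul]

/-- Summing the $q$-difference telescopes on each half. The endpoint terms vanish because
$(1;q)_\infty=0$, and the limits at $0$, both equal to $1$, cancel between the positive and the
negative nodes. -/
theorem qBeta_shift (hq0 : 0 < q) (hq1 : q < 1) (ha : 0 < a) (hc : c < 0) {s d : ℝ}
    (hs : Adm q a c s) (hd : Adm q a c d) :
    (1 - s * (a * q)) * (1 - s * (c * q)) * qBeta q a c s d =
      (1 - a * c * q ^ 2 * s * d) * qBeta q a c (s * q) d := by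
  have hs' : Adm q a c (s * q) := by simpa using hs.mul_pow hq0 hq1 1
  have S1 := (summable_qBeta hq0 hq1 ha hc hs hd).mul_left
    ((1 - s * (a * q)) * (1 - s * (c * q)))
  have S2 := (summable_qBeta hq0 hq1 ha hc hs' hd).mul_left (1 - a * c * q ^ 2 * s * d)
  have S := S1.sub S2
  rw [← sub_eq_zero, qBeta, qBeta, ← tsum_mul_left, ← tsum_mul_left, ← S1.tsum_sub S2]
  have el (n : ℕ) := qBetaWeight_shift hq0 hq1 ha hc hs hd
    (node_mem hq0 hq1 ha hc (Sum.inl n))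
  have er (n : ℕ) := qBetaWeight_shift hq0 hq1 ha hc hs hd
    (node_mem hq0 hq1 ha hc (Sum.inr n))
  have hl0 : qBetaWeight q (a * q) (c * q) s d (a * q) = 0 := by
    simp [qBetaWeight, div_self (mul_pos ha hq0).ne', qPochInf_one hq0 hq1]
  have hr0 : qBetaWeight q (a * q) (c * q) s d (c * q) = 0 := by
    simp [qBetaWeight, div_self (mul_neg_of_neg_of_pos hc hq0).ne, qPochInf_one hq0 hq1]
  set F : ℕ → ℝ := fun n => qBetaWeight q (a * q) (c * q) s d (a * q * q ^ n)
  set G : ℕ → ℝ := fun n => qBetaWeight q (a * q) (c * q) s d (c * q * q ^ n)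
  have hF : Tendsto F atTop (𝓝 1) := tendsto_qBetaWeight_mul_pow hq0 hq1 _ _ _ _ _
  have hG : Tendsto G atTop (𝓝 1) := tendsto_qBetaWeight_mul_pow hq0 hq1 _ _ _ _ _
  have hF0 : F 0 = 0 := by simpa [F] using hl0
  have hG0 : G 0 = 0 := by simpa [G] using hr0
  -- Summability of the telescoping series is obtained by dividing by $acq^2s$. For $s=0$ the claim
  -- is trivial.
  rcases eq_or_ne s 0 with rfl | hs0
  · simp
  have hK : a * c * q ^ 2 * s ≠ 0 := by
    have := ha.ne'; have := hc.ne; have := hq0.ne'; positivity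
  have el' (n : ℕ) : (1 - s * (a * q)) * (1 - s * (c * q)) *
      (|node q a c (Sum.inl n)| * qBetaWeight q a c s d (node q a c (Sum.inl n))) -
      (1 - a * c * q ^ 2 * s * d) *
      (|node q a c (Sum.inl n)| * qBetaWeight q a c (s * q) d (node q a c (Sum.inl n))) =
      a * c * q ^ 2 * s * (F n - F (n + 1)) := by
    have h1 : node q a c (Sum.inl n) = a * q * q ^ n := by simp [node]; ring
    have h2 : node q a c (Sum.inl n) * q = a * q * q ^ (n + 1) := by simp [node]; ring
    have h3 := el n
    rw [h2] at h3
    rw [abs_of_pos (node_inl_pos hq0 ha n)]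
    simp only [F]
    rw [← h1]
    linear_combination h3
  have er' (n : ℕ) : (1 - s * (a * q)) * (1 - s * (c * q)) *
      (|node q a c (Sum.inr n)| * qBetaWeight q a c s d (node q a c (Sum.inr n))) -
      (1 - a * c * q ^ 2 * s * d) *
      (|node q a c (Sum.inr n)| * qBetaWeight q a c (s * q) d (node q a c (Sum.inr n))) =
      -(a * c * q ^ 2 * s) * (G n - G (n + 1)) := by
    have h1 : node q a c (Sum.inr n) = c * q * q ^ n := by simp [node]; ring
    have h2 : node q a c (Sum.inr n) * q = c * q * q ^ (n + 1) := by simp [node]; ring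
    have h3 := er n
    rw [h2] at h3
    rw [abs_of_neg (node_inr_neg hq0 hc n)]
    simp only [G]
    rw [← h1]
    linear_combination -h3
  have Sl := S.comp_injective Sum.inl_injective
  have Sr := S.comp_injective Sum.inr_injective
  rw [Summable.tsum_sum (f := fun k => _) Sl Sr]
  have Sl' : Summable fun n => a * c * q ^ 2 * s * (F n - F (n + 1)) := Sl.congr el'
  have Sr' : Summable fun n => -(a * c * q ^ 2 * s) * (G n - G (n + 1)) := Sr.congr er'
  rw [tsum_congr el', tsum_congr er', tsum_mul_left, tsum_mul_left,
    tsum_sub_succ hF ((summable_mul_left_iff hK).mp Sl'),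
    tsum_sub_succ hG ((summable_mul_left_iff (neg_ne_zero.mpr hK)).mp Sr'), hF0, hG0]
  ring

theorem qBeta_mul_pow (hq0 : 0 < q) (hq1 : q < 1) (ha : 0 < a) (hc : c < 0) {s d : ℝ}
    (hs : Adm q a c s) (hd : Adm q a c d) (n : ℕ) :
    qPoch q (s * (a * q)) n * qPoch q (s * (c * q)) n * qBeta q a c s d =
      qPoch q (a * c * q ^ 2 * s * d) n * qBeta q a c (s * q ^ n) d := by
  induction n with
  | zero => simp [qPoch_zero]
  | succ n ih =>
    have h := qBeta_shift hq0 hq1 ha hc (hs.mul_pow hq0 hq1 n) hd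
    rw [qPoch_succ, qPoch_succ, qPoch_succ, pow_succ q n, ← mul_assoc s (q ^ n) q]
    linear_combination (1 - s * (a * q) * q ^ n) * (1 - s * (c * q) * q ^ n) * ih +
      qPoch q (a * c * q ^ 2 * s * d) n * h

/-- The functional equation is iterated and $sq^n\to0$, with dominated convergence for the integral.
-/
theorem qBeta_eq_zero_left (hq0 : 0 < q) (hq1 : q < 1) (ha : 0 < a) (hc : c < 0) {s d : ℝ}
    (hs : Adm q a c s) (hd : Adm q a c d) :
    qPochInf q (s * (a * q)) * qPochInf q (s * (c * q)) * qBeta q a c s d =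
      qPochInf q (a * c * q ^ 2 * s * d) * qBeta q a c 0 d :=
  tendsto_nhds_unique_of_eventuallyEq
    (((tendsto_qPoch hq0 hq1 _).mul (tendsto_qPoch hq0 hq1 _)).mul_const _)
    ((tendsto_qPoch hq0 hq1 _).mul (tendsto_qBeta hq0 hq1 ha hc hs hd))
    (Eventually.of_forall (qBeta_mul_pow hq0 hq1 ha hc hs hd))

theorem qBeta_comm (s d : ℝ) : qBeta q a c s d = qBeta q a c d s := by
  unfold qBeta qBetaWeight
  simp only [mul_comm (qPochInf q (s * _))]

theorem qBeta_eq_zero_zero (hq0 : 0 < q) (hq1 : q < 1) (ha : 0 < a) (hc : c < 0) {s d : ℝ}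
    (hs : Adm q a c s) (hd : Adm q a c d) :
    qPochInf q (s * (a * q)) * qPochInf q (s * (c * q)) *
        (qPochInf q (d * (a * q)) * qPochInf q (d * (c * q))) * qBeta q a c s d =
      qPochInf q (a * c * q ^ 2 * s * d) * qBeta q a c 0 0 := by
  have h1 := qBeta_eq_zero_left hq0 hq1 ha hc hs hd
  have h2 := qBeta_eq_zero_left hq0 hq1 ha hc hd Adm.zero
  rw [mul_zero, qPochInf_zero, one_mul, qBeta_comm] at h2
  linear_combination (qPochInf q (d * (a * q)) * qPochInf q (d * (c * q))) * h1 +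
    qPochInf q (a * c * q ^ 2 * s * d) * h2

/-- For $s=1/a$, $d=1/c$ the integrand is identically $1$, so the integral is a pair of geometric
series. Comparison with the product formula at these parameters gives the constant. -/
theorem qBeta_zero_zero (hq0 : 0 < q) (hq1 : q < 1) (ha : 0 < a) (hc : c < 0) :
    qBeta q a c 0 0 =
      (a - c) * q * qPochInf q q * qPochInf q (c * q / a) * qPochInf q (a * q / c) := by
  have A1 := adm_inv_left hq0 hq1 ha hc
  have A2 := adm_inv_right hq0 hq1 ha hc
  have h := qBeta_eq_zero_zero hq0 hq1 ha hc A1 A2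
  have e1 : 1 / a * (a * q) = q := by have := ha.ne'; field_simp
  have e2 : 1 / c * (c * q) = q := by have := hc.ne; field_simp
  have e3 : 1 / a * (c * q) = c * q / a := by ring
  have e4 : 1 / c * (a * q) = a * q / c := by ring
  have e5 : a * c * q ^ 2 * (1 / a) * (1 / c) = q * q := by
    have := ha.ne'; have := hc.ne; field_simp
  rw [e1, e2, e3, e4, e5, qPochInf_eq hq0 hq1 q] at h
  have hp : 0 < qPochInf q (q * q) := qPochInf_pos hq0 hq1 (by nlinarith)
  have hI : qBeta q a c (1 / a) (1 / c) * (1 - q) = (a - c) * q := by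
    have hw (k : ℕ ⊕ ℕ) : |node q a c k| * qBetaWeight q a c (1 / a) (1 / c) (node q a c k) =
        |node q a c k| := by
      have h1 := A1.mul_lt_one (node_mem hq0 hq1 ha hc k)
      have h2 := A2.mul_lt_one (node_mem hq0 hq1 ha hc k)
      unfold qBetaWeight
      simp only [one_div_mul_eq_div] at h1 h2 ⊢
      rw [div_self (mul_pos (qPochInf_pos hq0 hq1 h1) (qPochInf_pos hq0 hq1 h2)).ne', mul_one]
    have hS := summable_abs_node hq0 hq1 (a := a) (c := c)
    rw [qBeta, tsum_congr hw, Summable.tsum_sum (f := fun k => |node q a c k|)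
      (hS.comp_injective Sum.inl_injective) (hS.comp_injective Sum.inr_injective)]
    have l1 (n : ℕ) : |node q a c (Sum.inl n)| = a * q * q ^ n := by
      rw [abs_of_pos (node_inl_pos hq0 ha n)]; simp [node]; ring
    have l2 (n : ℕ) : |node q a c (Sum.inr n)| = -c * q * q ^ n := by
      rw [abs_of_neg (node_inr_neg hq0 hc n)]; simp [node]; ring
    rw [tsum_congr l1, tsum_congr l2, tsum_mul_left, tsum_mul_left,
      tsum_geometric_of_lt_one hq0.le hq1]
    have : 1 - q ≠ 0 := by linarith
    field_simp
    ring
  refine mul_left_cancel₀ hp.ne' ?_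
  rw [← h]
  rw [qPochInf_eq hq0 hq1 q]
  linear_combination (1 - q) * qPochInf q (q * q) ^ 2 * qPochInf q (c * q / a) *
    qPochInf q (a * q / c) * hI

end BigQJacobi
end

noncomputable section

namespace BigQJacobi

open Filter Topology

variable {q a b c : ℝ}

/-! ### Big `q`-Jacobi polynomials -/

/-- The coefficients of the big `q`-Jacobi polynomial in the basis `(x; q)_k`. -/
def jacobiCoef (q a b c : ℝ) (n k : ℕ) : ℝ :=
  qPoch q ((q ^ n)⁻¹) k * qPoch q (a * b * q ^ (n + 1)) k /
    (qPoch q (a * q) k * qPoch q (c * q) k * qPoch q q k) * q ^ k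

theorem qPoch_inv_pow_eq_zero (hq0 : 0 < q) {n k : ℕ} (h : n < k) :
    qPoch q ((q ^ n)⁻¹) k = 0 := by
  refine Finset.prod_eq_zero (Finset.mem_range.mpr h) ?_
  rw [inv_mul_cancel₀ (pow_pos hq0 n).ne', sub_self]

theorem jacobiCoef_eq_zero (hq0 : 0 < q) {n k : ℕ} (h : n < k) : jacobiCoef q a b c n k = 0 := by
  simp [jacobiCoef, qPoch_inv_pow_eq_zero hq0 h]

theorem jacobiCoef_zero_right (n : ℕ) : jacobiCoef q a b c n 0 = 1 := by
  simp [jacobiCoef, qPoch_zero]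

theorem bigQJacobi_eq_sum (hq0 : 0 < q) {n N : ℕ} (h : n < N) (x : ℝ) :
    bigQJacobi q a b c n x = ∑ k ∈ Finset.range N, jacobiCoef q a b c n k * qPoch q x k := by
  unfold bigQJacobi phi32
  rw [tsum_eq_sum (s := Finset.range N)]
  · refine Finset.sum_congr rfl fun k _ => ?_
    rw [jacobiCoef]; ring
  · intro k hk
    rw [Finset.mem_range, not_lt] at hk
    simp [qPoch_inv_pow_eq_zero hq0 (h.trans_le hk)]

theorem bigQJacobi_zero (hq0 : 0 < q) (x : ℝ) : bigQJacobi q a b c 0 x = 1 := by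
  rw [bigQJacobi_eq_sum hq0 Nat.zero_lt_one]
  simp [jacobiCoef_zero_right, qPoch_zero]

/-- The coefficient of `P_{n+1}` in the three-term recurrence. -/
def recUp (q a b c : ℝ) (n : ℕ) : ℝ :=
  (1 - a * q ^ (n + 1)) * (1 - c * q ^ (n + 1)) * abRatio q a b n / (1 - a * b * q ^ (2 * n + 2))

/-- The coefficient of `P_{n-1}` in the three-term recurrence. -/
def recDown (q a b c : ℝ) (n : ℕ) : ℝ :=
  -(a * c * q ^ (n + 1) * ((1 - q ^ n) * (1 - b * q ^ n) * (1 - a * b / c * q ^ n) /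
      ((1 - a * b * q ^ (2 * n)) * (1 - a * b * q ^ (2 * n + 1)))))

theorem coeffB_eq (n : ℕ) : coeffB q a b c n = recUp q a b c n + recDown q a b c n - 1 := by
  unfold coeffB recUp recDown; ring

/-- The conditions on the parameters of the big `q`-Jacobi polynomials. -/
structure Params (q a b c : ℝ) : Prop where
  q_pos : 0 < q
  q_lt : q < 1
  a_pos : 0 < a
  aq_lt : a * q < 1
  b_pos : 0 < b
  bq_lt : b * q < 1
  c_neg : c < 0

namespace Params

variable (h : Params q a b c)
include h

theorem pow_pos (n : ℕ) : 0 < q ^ n := _root_.pow_pos h.q_pos n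

theorem pow_le (n : ℕ) : q ^ n ≤ 1 := pow_le_one₀ h.q_pos.le h.q_lt.le

theorem a_mul_pow_lt (n : ℕ) : a * q ^ (n + 1) < 1 := by
  have := h.a_pos; have := h.aq_lt; have := h.pow_pos n; have := h.pow_le n; have := h.q_pos
  rw [pow_succ]
  nlinarith [mul_pos h.a_pos h.q_pos]

theorem b_mul_pow_lt (n : ℕ) : b * q ^ (n + 1) < 1 := by
  have := h.b_pos; have := h.bq_lt; have := h.pow_pos n; have := h.pow_le n; have := h.q_pos
  rw [pow_succ]
  nlinarith [mul_pos h.b_pos h.q_pos]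

/-- Writing the product as $(aq^{n+1})(bq)$ shows that the exponent must start at $2$. The value
$abq$ itself may be equal to or larger than $1$, which is why the index $0$ is separated in
`abRatio` and `abWeight`. -/
theorem ab_mul_pow_lt (n : ℕ) : a * b * q ^ (n + 2) < 1 := by
  have h1 := h.a_mul_pow_lt n
  have h2 := h.bq_lt
  have h3 := mul_pos h.b_pos h.q_pos
  have h4 := mul_pos h.a_pos (h.pow_pos (n + 1))
  calc a * b * q ^ (n + 2) = (a * q ^ (n + 1)) * (b * q) := by ring
    _ < 1 := by nlinarith

theorem c_mul_pow_neg (n : ℕ) : c * q ^ n < 0 := mul_neg_of_neg_of_pos h.c_neg (h.pow_pos n)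

theorem ab_div_c_neg : a * b / c < 0 := div_neg_of_pos_of_neg (mul_pos h.a_pos h.b_pos) h.c_neg

theorem qPoch_a_pos (k : ℕ) : 0 < qPoch q (a * q) k := qPoch_pos h.q_pos h.q_lt h.aq_lt k

theorem qPoch_b_pos (k : ℕ) : 0 < qPoch q (b * q) k := qPoch_pos h.q_pos h.q_lt h.bq_lt k

theorem qPoch_c_pos (k : ℕ) : 0 < qPoch q (c * q) k :=
  qPoch_pos h.q_pos h.q_lt (by linarith [h.c_mul_pow_neg 1, pow_one q ▸ h.c_mul_pow_neg 1]) k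

theorem qPoch_q_pos (k : ℕ) : 0 < qPoch q q k := qPoch_pos h.q_pos h.q_lt h.q_lt k

theorem qPoch_ab_div_c_pos (k : ℕ) : 0 < qPoch q (a * b * q / c) k := by
  refine qPoch_pos h.q_pos h.q_lt ?_ k
  have := mul_neg_of_neg_of_pos h.ab_div_c_neg h.q_pos
  rw [mul_div_right_comm]
  linarith

end Params

/-! ### The three-term recurrence. -/

/-- This is what remains of the recurrence for one coefficient after common factors are removed.
Here $M=q^m$, $K=q^k$, the degree is $m+1$, the coefficient index is $k+2$, and $A$, $C$ are the
upper and lower recurrence coefficients. Multiplying by the three denominators makes it polynomial.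
-/
theorem recurrence_identity {M K J A C : ℝ} (hJ : J = K * q ^ 2)
    (hX : 1 - a * b * (M ^ 2 * q ^ 2) ≠ 0) (hY : 1 - a * b * (M ^ 2 * q ^ 3) ≠ 0)
    (hZ : 1 - a * b * (M ^ 2 * q ^ 4) ≠ 0)
    (hA : A * ((1 - a * b * (M ^ 2 * q ^ 3)) * (1 - a * b * (M ^ 2 * q ^ 4))) =
      (1 - a * (M * q ^ 2)) * (1 - c * (M * q ^ 2)) * (1 - a * b * (M * q ^ 2)))
    (hC : C * ((1 - a * b * (M ^ 2 * q ^ 2)) * (1 - a * b * (M ^ 2 * q ^ 3))) =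
      -(a * (M * q ^ 2) * ((1 - M * q) * (1 - b * (M * q)) * (c - a * b * (M * q))))) :
    (1 - J) * (q ^ 2 * (M * q - 1) * (M - K) * (1 - a * b * M * q ^ 2) *
        (1 - a * b * M * q ^ 3 * K)) -
      (1 - a * J) * (1 - c * J) * (1 - J) * (M * q ^ 2 * (M * q - 1) * (1 - a * b * M * q ^ 2)) =
    A * J * ((M * q ^ 2 - 1) * (M * q - 1) * (1 - a * b * M * q ^ 3 * K) *
        (1 - a * b * M * q ^ 4 * K) - q ^ 2 * (M * q - 1) * (M - K) * (1 - a * b * M * q ^ 2) *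
        (1 - a * b * M * q ^ 3 * K)) +
    C * J * (q ^ 3 * (M - K) * (M - K * q) * (1 - a * b * M * q) * (1 - a * b * M * q ^ 2) -
      q ^ 2 * (M * q - 1) * (M - K) * (1 - a * b * M * q ^ 2) *
        (1 - a * b * M * q ^ 3 * K)) := by
  subst hJ
  refine mul_left_cancel₀ (mul_ne_zero (mul_ne_zero hX hY) hZ) ?_
  linear_combination
    (-(1 - a * b * (M ^ 2 * q ^ 2)) * (K * q ^ 2) *
      ((M * q ^ 2 - 1) * (M * q - 1) * (1 - a * b * M * q ^ 3 * K) *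
        (1 - a * b * M * q ^ 4 * K) - q ^ 2 * (M * q - 1) * (M - K) * (1 - a * b * M * q ^ 2) *
        (1 - a * b * M * q ^ 3 * K))) * hA +
    (-(1 - a * b * (M ^ 2 * q ^ 4)) * (K * q ^ 2) *
      (q ^ 3 * (M - K) * (M - K * q) * (1 - a * b * M * q) * (1 - a * b * M * q ^ 2) -
      q ^ 2 * (M * q - 1) * (M - K) * (1 - a * b * M * q ^ 2) *
        (1 - a * b * M * q ^ 3 * K))) * hC

/-- The coefficient of index $1$ would need $K=q^{-1}$ in the general identity and is treated
separately. -/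
theorem recurrence_identity_one {M A C : ℝ}
    (hX : 1 - a * b * (M ^ 2 * q ^ 2) ≠ 0) (hY : 1 - a * b * (M ^ 2 * q ^ 3) ≠ 0)
    (hZ : 1 - a * b * (M ^ 2 * q ^ 4) ≠ 0)
    (hA : A * ((1 - a * b * (M ^ 2 * q ^ 3)) * (1 - a * b * (M ^ 2 * q ^ 4))) =
      (1 - a * (M * q ^ 2)) * (1 - c * (M * q ^ 2)) * (1 - a * b * (M * q ^ 2)))
    (hC : C * ((1 - a * b * (M ^ 2 * q ^ 2)) * (1 - a * b * (M ^ 2 * q ^ 3))) =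
      -(a * (M * q ^ 2) * ((1 - M * q) * (1 - b * (M * q)) * (c - a * b * (M * q))))) :
    (1 - q) * (q * (M * q - 1) * (1 - a * b * M * q ^ 2)) -
      (1 - a * q) * (1 - c * q) * (1 - q) * (M * q ^ 2) =
    A * q * ((M * q ^ 2 - 1) * (1 - a * b * M * q ^ 3) -
      q * (M * q - 1) * (1 - a * b * M * q ^ 2)) +
    C * q * (q ^ 2 * (M - 1) * (1 - a * b * M * q) - q * (M * q - 1) * (1 - a * b * M * q ^ 2)) := by
  refine mul_left_cancel₀ (mul_ne_zero (mul_ne_zero hX hY) hZ) ?_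
  linear_combination
    (-(1 - a * b * (M ^ 2 * q ^ 2)) * q * ((M * q ^ 2 - 1) * (1 - a * b * M * q ^ 3) -
      q * (M * q - 1) * (1 - a * b * M * q ^ 2))) * hA +
    (-(1 - a * b * (M ^ 2 * q ^ 4)) * q * (q ^ 2 * (M - 1) * (1 - a * b * M * q) -
      q * (M * q - 1) * (1 - a * b * M * q ^ 2))) * hC

namespace Params

variable (h : Params q a b c)
include h

theorem recUp_succ_mul (m : ℕ) :
    recUp q a b c (m + 1) * ((1 - a * b * ((q ^ m) ^ 2 * q ^ 3)) *
      (1 - a * b * ((q ^ m) ^ 2 * q ^ 4))) =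
      (1 - a * (q ^ m * q ^ 2)) * (1 - c * (q ^ m * q ^ 2)) * (1 - a * b * (q ^ m * q ^ 2)) := by
  have h1 := (sub_pos.mpr (h.ab_mul_pow_lt (2 * m + 1))).ne'
  have h2 := (sub_pos.mpr (h.ab_mul_pow_lt (2 * m + 2))).ne'
  have e1 : q ^ (2 * m + 1 + 2) = (q ^ m) ^ 2 * q ^ 3 := by ring
  have e2 : q ^ (2 * m + 2 + 2) = (q ^ m) ^ 2 * q ^ 4 := by ring
  have e3 : q ^ (2 * (m + 1) + 1) = (q ^ m) ^ 2 * q ^ 3 := by ring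
  have e4 : q ^ (2 * (m + 1) + 2) = (q ^ m) ^ 2 * q ^ 4 := by ring
  have e5 : q ^ (m + 1 + 1) = q ^ m * q ^ 2 := by ring
  rw [e1] at h1
  rw [e2] at h2
  rw [recUp, abRatio, if_neg (Nat.succ_ne_zero m), e3, e4, e5]
  rw [← mul_div_assoc, div_div, div_mul_cancel₀ _ (mul_ne_zero h1 h2)]

theorem recDown_succ_mul (m : ℕ) :
    recDown q a b c (m + 1) * ((1 - a * b * ((q ^ m) ^ 2 * q ^ 2)) *
      (1 - a * b * ((q ^ m) ^ 2 * q ^ 3))) =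
      -(a * (q ^ m * q ^ 2) * ((1 - q ^ m * q) * (1 - b * (q ^ m * q)) *
        (c - a * b * (q ^ m * q)))) := by
  have h1 := (sub_pos.mpr (h.ab_mul_pow_lt (2 * m))).ne'
  have h2 := (sub_pos.mpr (h.ab_mul_pow_lt (2 * m + 1))).ne'
  have e1 : q ^ (2 * m + 2) = (q ^ m) ^ 2 * q ^ 2 := by ring
  have e2 : q ^ (2 * m + 1 + 2) = (q ^ m) ^ 2 * q ^ 3 := by ring
  have e3 : q ^ (2 * (m + 1)) = (q ^ m) ^ 2 * q ^ 2 := by ring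
  have e4 : q ^ (2 * (m + 1) + 1) = (q ^ m) ^ 2 * q ^ 3 := by ring
  have e5 : q ^ (m + 1 + 1) = q ^ m * q ^ 2 := by ring
  have e6 : q ^ (m + 1) = q ^ m * q := by ring
  rw [e1] at h1
  rw [e2] at h2
  have hc := h.c_neg.ne
  rw [recDown, e3, e4, e5, e6, neg_mul, mul_assoc, div_mul_cancel₀ _ (mul_ne_zero h1 h2)]
  field_simp

/-- This compares coefficients of $(x;q)_{j+1}$, using $x(x;q)_k=q^{-k}((x;q)_k-(x;q)_{k+1})$. Since
the middle coefficient is $1$ minus the two outer ones, the right side involves only differences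
$P_{m+2}-P_{m+1}$ and $P_m-P_{m+1}$. -/
theorem jacobiCoef_recurrence (m j : ℕ) :
    ((q ^ (j + 1))⁻¹ - 1) * jacobiCoef q a b c (m + 1) (j + 1) -
        (q ^ j)⁻¹ * jacobiCoef q a b c (m + 1) j =
      recUp q a b c (m + 1) *
        (jacobiCoef q a b c (m + 2) (j + 1) - jacobiCoef q a b c (m + 1) (j + 1)) +
      recDown q a b c (m + 1) *
        (jacobiCoef q a b c m (j + 1) - jacobiCoef q a b c (m + 1) (j + 1)) := by
  have hX := (sub_pos.mpr (h.ab_mul_pow_lt (2 * m))).ne'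
  have hY := (sub_pos.mpr (h.ab_mul_pow_lt (2 * m + 1))).ne'
  have hZ := (sub_pos.mpr (h.ab_mul_pow_lt (2 * m + 2))).ne'
  rw [show q ^ (2 * m + 2) = (q ^ m) ^ 2 * q ^ 2 by ring] at hX
  rw [show q ^ (2 * m + 1 + 2) = (q ^ m) ^ 2 * q ^ 3 by ring] at hY
  rw [show q ^ (2 * m + 2 + 2) = (q ^ m) ^ 2 * q ^ 4 by ring] at hZ
  have hA := h.recUp_succ_mul m
  have hC := h.recDown_succ_mul m
  have hM := (h.pow_pos m).ne'
  have q0 := h.q_pos.ne'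
  have u1 : (q ^ (m + 1))⁻¹ = (q ^ m)⁻¹ * q⁻¹ := by rw [pow_succ, mul_inv]
  have u2 : (q ^ (m + 2))⁻¹ = (q ^ m)⁻¹ * q⁻¹ * q⁻¹ := by rw [pow_succ, pow_succ, mul_inv, mul_inv]
  have v0 : a * b * q ^ (m + 1) = a * b * q ^ m * q := by ring
  have v1 : a * b * q ^ (m + 1 + 1) = a * b * q ^ m * q ^ 2 := by ring
  have v2 : a * b * q ^ (m + 2 + 1) = a * b * q ^ m * q ^ 3 := by ring
  have D0 := (mul_pos (mul_pos (h.qPoch_a_pos j) (h.qPoch_c_pos j)) (h.qPoch_q_pos j)).ne'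
  have D1 := (mul_pos (mul_pos (h.qPoch_a_pos (j + 1)) (h.qPoch_c_pos (j + 1)))
    (h.qPoch_q_pos (j + 1))).ne'
  unfold jacobiCoef
  rw [u1, u2, v0, v1, v2]
  rw [qPoch_succ q (a * q), qPoch_succ q (c * q), qPoch_succ q q] at D1 ⊢
  rcases j with _ | k
  · have key := recurrence_identity_one hX hY hZ hA hC
    simp only [qPoch_zero, qPoch_succ, pow_zero, zero_add, pow_one, mul_one, one_mul, inv_one,
      div_one] at D1 ⊢
    generalize recUp q a b c (m + 1) = A at *
    generalize recDown q a b c (m + 1) = C at *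
    generalize q ^ m = M at *
    generalize hE : (1 - a * q) * (1 - c * q) * (1 - q) = E at *
    field_simp
    refine mul_left_cancel₀ q0 ?_
    linear_combination key
  · have key := recurrence_identity (K := q ^ k) (J := q ^ (k + 2)) (by ring) hX hY hZ hA hC
    -- All shifted factorials depending on the degree are reduced to the two common factors
    -- $(q^{-m};q)_k$ and $(abq^{m+3};q)_k$.
    have r0 : qPoch q (q ^ m)⁻¹ (k + 1 + 1) = qPoch q (q ^ m)⁻¹ k *
      (1 - (q ^ m)⁻¹ * q ^ k) * (1 - (q ^ m)⁻¹ * (q ^ k * q)) := by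
      rw [qPoch_succ, qPoch_succ, pow_succ]
    have r1' : qPoch q ((q ^ m)⁻¹ * q⁻¹) (k + 1) = (1 - (q ^ m)⁻¹ * q⁻¹) * qPoch q (q ^ m)⁻¹ k := by
      rw [qPoch_succ_left, inv_mul_cancel_right₀ q0]
    have r1 : qPoch q ((q ^ m)⁻¹ * q⁻¹) (k + 1 + 1) = (1 - (q ^ m)⁻¹ * q⁻¹) *
        (qPoch q (q ^ m)⁻¹ k * (1 - (q ^ m)⁻¹ * q ^ k)) := by
      rw [qPoch_succ_left, inv_mul_cancel_right₀ q0, qPoch_succ]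
    have r2 : qPoch q ((q ^ m)⁻¹ * q⁻¹ * q⁻¹) (k + 1 + 1) = (1 - (q ^ m)⁻¹ * q⁻¹ * q⁻¹) *
        ((1 - (q ^ m)⁻¹ * q⁻¹) * qPoch q (q ^ m)⁻¹ k) := by
      rw [qPoch_succ_left, inv_mul_cancel_right₀ q0, r1']
    have s2 : qPoch q (a * b * q ^ m * q ^ 3) (k + 1 + 1) = qPoch q (a * b * q ^ m * q ^ 3) k *
        (1 - a * b * q ^ m * q ^ 3 * q ^ k) * (1 - a * b * q ^ m * q ^ 3 * (q ^ k * q)) := by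
      rw [qPoch_succ, qPoch_succ, pow_succ q k]
    have s1' : qPoch q (a * b * q ^ m * q ^ 2) (k + 1) = (1 - a * b * q ^ m * q ^ 2) *
        qPoch q (a * b * q ^ m * q ^ 3) k := by
      rw [qPoch_succ_left, mul_assoc _ (q ^ 2) q, ← pow_succ]
    have s1 : qPoch q (a * b * q ^ m * q ^ 2) (k + 1 + 1) = (1 - a * b * q ^ m * q ^ 2) *
        (qPoch q (a * b * q ^ m * q ^ 3) k * (1 - a * b * q ^ m * q ^ 3 * q ^ k)) := by
      rw [qPoch_succ_left, mul_assoc _ (q ^ 2) q, ← pow_succ, qPoch_succ]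
    have s0 : qPoch q (a * b * q ^ m * q) (k + 1 + 1) = (1 - a * b * q ^ m * q) *
        ((1 - a * b * q ^ m * q ^ 2) * qPoch q (a * b * q ^ m * q ^ 3) k) := by
      rw [qPoch_succ_left, mul_assoc _ q q, ← pow_two, s1']
    have z1 : a * q * q ^ (k + 1) = a * q ^ (k + 2) := by ring
    have z2 : c * q * q ^ (k + 1) = c * q ^ (k + 2) := by ring
    have z3 : q * q ^ (k + 1) = q ^ (k + 2) := by ring
    have hJ0 := (h.pow_pos (k + 2)).ne'
    have hJ : q ^ (k + 1) * q = q ^ (k + 2) := by ring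
    have hK : q ^ (k + 1) = q ^ k * q := by ring
    have hK0 := (h.pow_pos k).ne'
    rw [r0, r1', r1, r2, s2, s1', s1, s0]
    rw [show k + 1 + 1 = k + 2 from rfl]
    rw [z1, z2, z3] at D1 ⊢
    have D0' : qPoch q (a * q) (k + 1) * (1 - a * q ^ (k + 2)) * (qPoch q (c * q) (k + 1) *
        (1 - c * q ^ (k + 2))) * (qPoch q q (k + 1) * (1 - q ^ (k + 2))) =
        (qPoch q (a * q) (k + 1) * qPoch q (c * q) (k + 1) * qPoch q q (k + 1)) *
        ((1 - a * q ^ (k + 2)) * (1 - c * q ^ (k + 2)) * (1 - q ^ (k + 2))) := by ring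
    rw [D0'] at D1 ⊢
    have D2 := right_ne_zero_of_mul D1
    generalize qPoch q (a * q) (k + 1) * qPoch q (c * q) (k + 1) * qPoch q q (k + 1) = d at *
    generalize qPoch q (q ^ m)⁻¹ k = r at *
    generalize qPoch q (a * b * q ^ m * q ^ 3) k = s at *
    generalize recUp q a b c (m + 1) = A at *
    generalize recDown q a b c (m + 1) = C at *
    have hJ2 : q ^ (k + 2) = q ^ k * q ^ 2 := by ring
    rw [hK]
    rw [hJ2] at key D2 ⊢
    generalize hE : (1 - a * (q ^ k * q ^ 2)) * (1 - c * (q ^ k * q ^ 2)) *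
      (1 - (q ^ k * q ^ 2)) = E at *
    generalize q ^ m = M at *
    generalize q ^ k = K at *
    field_simp
    refine mul_left_cancel₀ (pow_ne_zero 2 q0) ?_
    linear_combination r * s * key

theorem mul_qPoch (x : ℝ) (k : ℕ) :
    x * qPoch q x k = (q ^ k)⁻¹ * (qPoch q x k - qPoch q x (k + 1)) := by
  have := (h.pow_pos k).ne'
  rw [qPoch_succ]
  field_simp
  ring

theorem bigQJacobi_recurrence_succ (m : ℕ) (x : ℝ) :
    x * bigQJacobi q a b c (m + 1) x =
      recUp q a b c (m + 1) * bigQJacobi q a b c (m + 2) x -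
        coeffB q a b c (m + 1) * bigQJacobi q a b c (m + 1) x +
        recDown q a b c (m + 1) * bigQJacobi q a b c m x := by
  -- All three polynomials are expanded over one common range. The vanishing top coefficient allows
  -- the index shift, and the constant terms, all equal to $1$, are split off.
  have hN : jacobiCoef q a b c (m + 1) (m + 3) = 0 := jacobiCoef_eq_zero h.q_pos (by lia)
  have e1 : x * bigQJacobi q a b c (m + 1) x =
      ∑ k ∈ Finset.range (m + 3), (q ^ (k + 1))⁻¹ * jacobiCoef q a b c (m + 1) (k + 1) *
        qPoch q x (k + 1) + 1 -
      ∑ k ∈ Finset.range (m + 3), (q ^ k)⁻¹ * jacobiCoef q a b c (m + 1) k *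
        qPoch q x (k + 1) := by
    have e2 : ∑ k ∈ Finset.range (m + 3), (q ^ (k + 1))⁻¹ * jacobiCoef q a b c (m + 1) (k + 1) *
        qPoch q x (k + 1) + 1 = ∑ k ∈ Finset.range (m + 3), (q ^ k)⁻¹ *
          jacobiCoef q a b c (m + 1) k * qPoch q x k := by
      have e3 := Finset.sum_range_succ' (fun k => (q ^ k)⁻¹ *
          jacobiCoef q a b c (m + 1) k * qPoch q x k) (m + 3)
      rw [Finset.sum_range_succ, hN] at e3
      simpa [jacobiCoef_zero_right, qPoch_zero] using e3.symm
    rw [e2, bigQJacobi_eq_sum h.q_pos (show m + 1 < m + 3 by lia), Finset.mul_sum,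
      ← Finset.sum_sub_distrib]
    refine Finset.sum_congr rfl fun k _ => ?_
    linear_combination jacobiCoef q a b c (m + 1) k * h.mul_qPoch x k
  have e (n : ℕ) (hn : n ≤ m + 2) : bigQJacobi q a b c n x =
      ∑ k ∈ Finset.range (m + 3), jacobiCoef q a b c n (k + 1) * qPoch q x (k + 1) + 1 := by
    rw [bigQJacobi_eq_sum h.q_pos (show n < m + 4 by lia), Finset.sum_range_succ']
    simp [jacobiCoef_zero_right, qPoch_zero]
  rw [e1, coeffB_eq, e _ le_rfl, e (m + 1) (by lia), e m (by lia)]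
  have key : ∑ k ∈ Finset.range (m + 3), (((q ^ (k + 1))⁻¹ - 1) *
      jacobiCoef q a b c (m + 1) (k + 1) - (q ^ k)⁻¹ * jacobiCoef q a b c (m + 1) k) *
        qPoch q x (k + 1) = ∑ k ∈ Finset.range (m + 3), (recUp q a b c (m + 1) *
        (jacobiCoef q a b c (m + 2) (k + 1) - jacobiCoef q a b c (m + 1) (k + 1)) +
      recDown q a b c (m + 1) *
        (jacobiCoef q a b c m (k + 1) - jacobiCoef q a b c (m + 1) (k + 1))) *
        qPoch q x (k + 1) :=
    Finset.sum_congr rfl fun k _ => by rw [h.jacobiCoef_recurrence m k]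
  simp only [sub_mul, add_mul, mul_sub, mul_assoc, Finset.sum_sub_distrib, Finset.sum_add_distrib,
    ← Finset.mul_sum, one_mul] at key ⊢
  linear_combination key

theorem bigQJacobi_recurrence_zero (x : ℝ) :
    x * bigQJacobi q a b c 0 x =
      recUp q a b c 0 * bigQJacobi q a b c 1 x - coeffB q a b c 0 * bigQJacobi q a b c 0 x := by
  have h1 := (sub_pos.mpr (h.ab_mul_pow_lt 0)).ne'
  have h2 := h.qPoch_a_pos 1
  have h3 := h.qPoch_c_pos 1
  have h4 := h.qPoch_q_pos 1
  have e : bigQJacobi q a b c 1 x = 1 - (1 - a * b * q ^ 2) * (1 - x) /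
      ((1 - a * q) * (1 - c * q)) := by
    have h5 := h.q_pos.ne'
    rw [bigQJacobi_eq_sum h.q_pos (show 1 < 2 by lia), Finset.sum_range_succ,
      Finset.sum_range_one, jacobiCoef_zero_right, jacobiCoef]
    simp only [qPoch_succ, qPoch_zero, pow_zero, pow_one, mul_one, one_mul] at *
    have h2' := h2.ne'
    have h3' := h3.ne'
    have h4' := h4.ne'
    field_simp
    ring
  have e1 : recUp q a b c 0 = (1 - a * q) * (1 - c * q) / (1 - a * b * q ^ 2) := by
    simp [recUp, abRatio]
  have e2 : recDown q a b c 0 = 0 := by simp [recDown]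
  rw [coeffB_eq, e, e1, e2, bigQJacobi_zero h.q_pos]
  simp only [qPoch_succ, qPoch_zero, pow_zero, mul_one, one_mul, zero_add] at h1 h2 h3
  have h2' := h2.ne'
  have h3' := h3.ne'
  generalize 1 - a * b * q ^ 2 = X at *
  generalize 1 - a * q = Y at *
  generalize 1 - c * q = Z at *
  field_simp
  ring

end Params

/-- A terminating `q`-Chu–Vandermonde sum in indefinite form. -/
theorem sum_range_qPoch_balanced (hq0 : 0 < q) (hq1 : q < 1) {u v : ℝ} (huv : u * v * q < 1)
    (K : ℕ) :
    ∑ k ∈ Finset.range (K + 1), qPoch q u k * qPoch q v k /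
        (qPoch q (u * v * q) k * qPoch q q k) * q ^ k =
      qPoch q (u * q) K * qPoch q (v * q) K / (qPoch q (u * v * q) K * qPoch q q K) := by
  induction K with
  | zero => simp [qPoch_zero]
  | succ K ih =>
    have p1 := (qPoch_pos hq0 hq1 huv (K + 1)).ne'
    have p2 := (qPoch_pos hq0 hq1 hq1 (K + 1)).ne'
    rw [Finset.sum_range_succ, ih, qPoch_succ_left q u, qPoch_succ_left q v]
    rw [qPoch_succ] at p1 p2
    rw [qPoch_succ, qPoch_succ, qPoch_succ, qPoch_succ, pow_succ]
    have n1 := left_ne_zero_of_mul p1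
    have n2 := right_ne_zero_of_mul p1
    have n3 := left_ne_zero_of_mul p2
    have n4 := right_ne_zero_of_mul p2
    generalize q ^ K = k at *
    obtain ⟨X, hX⟩ : ∃ X, X = 1 - u * v * q * k := ⟨_, rfl⟩
    obtain ⟨Y, hY⟩ : ∃ Y, Y = 1 - q * k := ⟨_, rfl⟩
    rw [← hX] at n2 ⊢
    rw [← hY] at n4 ⊢
    field_simp
    rw [hX, hY]
    ring

end BigQJacobi
end

noncomputable section

namespace BigQJacobi

open Filter Topology

variable {q a b c : ℝ}

/-! ### The orthogonality measure -/

theorem hasSum_of_eq {ι M : Type*} [AddCommMonoid M] [TopologicalSpace M] {f g : ι → M} {x y : M}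
    (hf : HasSum f x) (hg : ∀ k, g k = f k)
    (hy : y = x) : HasSum g y := by
  rw [funext hg, hy]; exact hf

theorem qBeta_weight_aux {a s A A' B C D D' E E' G H I Q Q' p : ℝ} (ha : a ≠ 0) (hs : s ≠ 0)
    (hG : G ≠ 0) (hH : H ≠ 0) (hE : E ≠ 0) (hQ : Q ≠ 0) (hA' : A' ≠ 0) (hD' : D' ≠ 0)
    (key : A * A' * C * (D * D') * B * I = G * (s * q * (Q * Q') * H * (E * E'))) :
    B * C / (G * (s / a * H)) * (A * D * p / (E * Q)) * I =
      a * (p * q) * (Q' * E' / (A' * D')) := by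
  have h1 : B * C / (G * (s / a * H)) * (A * D * p / (E * Q)) * I =
      A * A' * C * (D * D') * B * I * (a * p / (G * s * H * E * Q * A' * D')) := by
    field_simp
  rw [h1, key]
  field_simp

namespace Params

variable (h : Params q a b c)
include h

theorem adm_one : Adm q a c 1 :=
  ⟨by simpa using h.aq_lt, by simpa using (pow_one q ▸ h.c_mul_pow_neg 1).trans one_pos⟩

theorem adm_b : Adm q a c (b / c) := by
  constructor
  · have := mul_pos h.a_pos h.q_pos
    exact (mul_neg_of_neg_of_pos (div_neg_of_pos_of_neg h.b_pos h.c_neg) this).trans one_pos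
  · rw [← mul_assoc, div_mul_cancel₀ _ h.c_neg.ne]; exact h.bq_lt

theorem qBeta_one_b :
    qPochInf q (a * q) * qPochInf q (c * q) * qPochInf q (a * b * q / c) * qPochInf q (b * q) *
        qBeta q a c 1 (b / c) =
      qPochInf q (a * b * q ^ 2) * ((a - c) * q * qPochInf q q * qPochInf q (c * q / a) *
        qPochInf q (a * q / c)) := by
  have h1 := qBeta_eq_zero_zero h.q_pos h.q_lt h.a_pos h.c_neg h.adm_one h.adm_b
  have hc := h.c_neg.ne
  rw [qBeta_zero_zero h.q_pos h.q_lt h.a_pos h.c_neg, one_mul, one_mul,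
    show b / c * (a * q) = a * b * q / c by ring, show b / c * (c * q) = b * q by field_simp,
    show a * c * q ^ 2 * 1 * (b / c) = a * b * q ^ 2 by field_simp] at h1
  linear_combination h1

theorem qBeta_pos : 0 < qBeta q a c 1 (b / c) := by
  refine (summable_qBeta h.q_pos h.q_lt h.a_pos h.c_neg h.adm_one h.adm_b).tsum_pos
    (fun k => ?_) (Sum.inl 0) ?_
  · exact mul_nonneg (abs_nonneg _) (qBetaWeight_pos h.q_pos h.q_lt h.a_pos h.c_neg h.adm_one
      h.adm_b (node_mem h.q_pos h.q_lt h.a_pos h.c_neg k)).le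
  · exact mul_pos (abs_pos.mpr (node_inl_pos h.q_pos h.a_pos 0).ne')
      (qBetaWeight_pos h.q_pos h.q_lt h.a_pos h.c_neg h.adm_one
      h.adm_b (node_mem h.q_pos h.q_lt h.a_pos h.c_neg _))

theorem a_div_c_neg : a / c < 0 := div_neg_of_pos_of_neg h.a_pos h.c_neg

theorem c_div_a_neg : c / a < 0 := div_neg_of_neg_of_pos h.c_neg h.a_pos

theorem aq_div_c_lt : a * q / c < 1 := by
  rw [mul_div_right_comm]
  exact (mul_neg_of_neg_of_pos h.a_div_c_neg h.q_pos).trans one_pos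

theorem cq_div_a_lt : c * q / a < 1 := by
  rw [mul_div_right_comm]
  exact (mul_neg_of_neg_of_pos h.c_div_a_neg h.q_pos).trans one_pos

theorem abq_div_c_lt : a * b * q / c < 1 := by
  rw [mul_div_right_comm]
  exact (mul_neg_of_neg_of_pos h.ab_div_c_neg h.q_pos).trans one_pos

theorem cq_lt : c * q < 1 := (pow_one q ▸ h.c_mul_pow_neg 1).trans one_pos

theorem qPochInf_pos_of {x : ℝ} (hx : x < 1) : 0 < qPochInf q x := qPochInf_pos h.q_pos h.q_lt hx

theorem qPoch_pos_of {x : ℝ} (hx : x < 1) (n : ℕ) : 0 < qPoch q x n :=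
  qPoch_pos h.q_pos h.q_lt hx n

theorem mul_pow_lt {x : ℝ} (hx : x < 1) (n : ℕ) : x * q ^ n < 1 := by
  have := h.pow_pos n
  have := h.pow_le n
  rcases le_total x 0 with h0 | h0 <;> nlinarith

/-- Each infinite product in the evaluated integral splits at index $n$: the finite parts form the
stated weight, the tails form $w(aq^{n+1})$. The first factor $1-c/a$ of $(c/a;q)_\infty$ accounts
for the $a-c$ in the integral. -/
theorem constC_mul_weight (n : ℕ) :
    constC q a b c * weight q a b c n * qBeta q a c 1 (b / c) =
      a * q ^ (n + 1) * qBetaWeight q a c 1 (b / c) (a * q ^ (n + 1)) := by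
  have key := h.qBeta_one_b
  have a0 := h.a_pos.ne'
  have ac : a - c ≠ 0 := by have := h.a_pos; have := h.c_neg; linarith
  have sp {x : ℝ} (hx : x < 1) := qPochInf_eq_mul h.q_pos h.q_lt x n
  have e1 : a * q ^ (n + 1) / a = q * q ^ n := by field_simp; ring
  have e2 : a * q ^ (n + 1) / c = a * q / c * q ^ n := by ring
  have e3 : 1 * (a * q ^ (n + 1)) = a * q * q ^ n := by ring
  have e4 : b / c * (a * q ^ (n + 1)) = a * b * q / c * q ^ n := by ring
  have e5 : 1 - c / a = (a - c) / a := by field_simp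
  unfold constC weight qBetaWeight
  rw [e1, e2, e3, e4, qPochInf_eq h.q_pos h.q_lt (c / a), e5, div_mul_eq_mul_div c a q, pow_succ q n]
  rw [sp h.q_lt, sp h.aq_div_c_lt, sp h.aq_lt, sp h.abq_div_c_lt] at key
  exact qBeta_weight_aux a0 ac (h.qPochInf_pos_of (h.ab_mul_pow_lt 0)).ne'
    (h.qPochInf_pos_of h.cq_div_a_lt).ne' (h.qPoch_pos_of h.aq_div_c_lt n).ne'
    (h.qPoch_pos_of h.q_lt n).ne' (h.qPochInf_pos_of (h.mul_pow_lt h.aq_lt n)).ne'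
    (h.qPochInf_pos_of (h.mul_pow_lt h.abq_div_c_lt n)).ne' key

theorem constC'_mul_weight' (n : ℕ) :
    constC' q a b c * weight' q a b c n * qBeta q a c 1 (b / c) =
      -(c * q ^ (n + 1)) * qBetaWeight q a c 1 (b / c) (c * q ^ (n + 1)) := by
  have key := h.qBeta_one_b
  have c0 := h.c_neg.ne
  have ac : a - c ≠ 0 := by have := h.a_pos; have := h.c_neg; linarith
  have sp {x : ℝ} (hx : x < 1) := qPochInf_eq_mul h.q_pos h.q_lt x n
  have e1 : c * q ^ (n + 1) / c = q * q ^ n := by field_simp; ring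
  have e2 : c * q ^ (n + 1) / a = c * q / a * q ^ n := by ring
  have e3 : 1 * (c * q ^ (n + 1)) = c * q * q ^ n := by ring
  have e4 : b / c * (c * q ^ (n + 1)) = b * q * q ^ n := by field_simp; ring
  have e5 : 1 - a / c = (a - c) / -c := by field_simp; ring
  unfold constC' weight' qBetaWeight
  rw [e1, e2, e3, e4, qPochInf_eq h.q_pos h.q_lt (a / c), e5, div_mul_eq_mul_div a c q, pow_succ q n]
  rw [sp h.q_lt, sp h.cq_div_a_lt, sp h.cq_lt, sp h.bq_lt] at key
  -- The same algebra applies with $-c$ in the role of $a$.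
  have := qBeta_weight_aux (neg_ne_zero.mpr c0) ac (h.qPochInf_pos_of (h.ab_mul_pow_lt 0)).ne'
    (h.qPochInf_pos_of h.aq_div_c_lt).ne' (h.qPoch_pos_of h.cq_div_a_lt n).ne'
    (h.qPoch_pos_of h.q_lt n).ne' (h.qPochInf_pos_of (h.mul_pow_lt h.cq_lt n)).ne'
    (h.qPochInf_pos_of (h.mul_pow_lt h.bq_lt n)).ne'
    (A := qPoch q (c * q) n) (C := qPochInf q (a * q)) (D := qPoch q (b * q) n)
    (B := qPochInf q (a * b * q / c)) (p := q ^ n) (I := qBeta q a c 1 (b / c)) (q := q)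
    (Q' := qPochInf q (q * q ^ n)) (E' := qPochInf q (c * q / a * q ^ n))
    (by linear_combination key)
  rw [zero_add] at this
  linear_combination this

theorem constC_pos : 0 < constC q a b c :=
  div_pos (mul_pos (h.qPochInf_pos_of h.bq_lt) (h.qPochInf_pos_of h.cq_lt))
    (mul_pos (h.qPochInf_pos_of (h.ab_mul_pow_lt 0))
      (h.qPochInf_pos_of (h.c_div_a_neg.trans one_pos)))

theorem constC'_pos : 0 < constC' q a b c :=
  div_pos (mul_pos (h.qPochInf_pos_of h.aq_lt) (h.qPochInf_pos_of h.abq_div_c_lt))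
    (mul_pos (h.qPochInf_pos_of (h.ab_mul_pow_lt 0))
      (h.qPochInf_pos_of (h.a_div_c_neg.trans one_pos)))

theorem weight_pos (n : ℕ) : 0 < weight q a b c n :=
  div_pos (mul_pos (mul_pos (h.qPoch_pos_of h.aq_lt n) (h.qPoch_pos_of h.abq_div_c_lt n))
    (h.pow_pos n)) (mul_pos (h.qPoch_pos_of h.aq_div_c_lt n) (h.qPoch_pos_of h.q_lt n))

theorem weight'_pos (n : ℕ) : 0 < weight' q a b c n :=
  div_pos (mul_pos (mul_pos (h.qPoch_pos_of h.bq_lt n) (h.qPoch_pos_of h.cq_lt n))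
    (h.pow_pos n)) (mul_pos (h.qPoch_pos_of h.cq_div_a_lt n) (h.qPoch_pos_of h.q_lt n))

theorem normFactor_pos (k : ℕ ⊕ ℕ) : 0 < normFactor q a b c k := by
  rcases k with n | n
  · exact Real.sqrt_pos.mpr (mul_pos h.constC_pos (h.weight_pos n))
  · exact Real.sqrt_pos.mpr (mul_pos h.constC'_pos (h.weight'_pos n))

theorem normFactor_sq_inl (n : ℕ) :
    normFactor q a b c (Sum.inl n) ^ 2 = constC q a b c * weight q a b c n :=
  Real.sq_sqrt (mul_pos h.constC_pos (h.weight_pos n)).le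

theorem normFactor_sq_inr (n : ℕ) :
    normFactor q a b c (Sum.inr n) ^ 2 = constC' q a b c * weight' q a b c n :=
  Real.sq_sqrt (mul_pos h.constC'_pos (h.weight'_pos n)).le

theorem normFactor_sq (k : ℕ ⊕ ℕ) :
    normFactor q a b c k ^ 2 =
      |node q a c k| * qBetaWeight q a c 1 (b / c) (node q a c k) / qBeta q a c 1 (b / c) := by
  rw [eq_div_iff h.qBeta_pos.ne']
  rcases k with n | n
  · rw [h.normFactor_sq_inl, h.constC_mul_weight, abs_of_pos (node_inl_pos h.q_pos h.a_pos n)]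
    rfl
  · rw [h.normFactor_sq_inr, h.constC'_mul_weight', abs_of_neg (node_inr_neg h.q_pos h.c_neg n)]
    rfl

/-- The moments of the orthogonality measure. -/
theorem hasSum_qPoch (j : ℕ) :
    HasSum (fun k => normFactor q a b c k ^ 2 * qPoch q (node q a c k) j)
      (qPoch q (a * q) j * qPoch q (c * q) j / qPoch q (a * b * q ^ 2) j) := by
  -- The factor $(x;q)_j$ cancels the start of $(x;q)_\infty$, so the moment is the beta integral
  -- with $s=q^j$, divided by the one with $s=1$.
  have hA : Adm q a c (1 * q ^ j) := h.adm_one.mul_pow h.q_pos h.q_lt j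
  have hS := ((summable_qBeta h.q_pos h.q_lt h.a_pos h.c_neg hA h.adm_b).hasSum).div_const
    (qBeta q a c 1 (b / c))
  have hI := qBeta_mul_pow h.q_pos h.q_lt h.a_pos h.c_neg h.adm_one h.adm_b j
  have hc := h.c_neg.ne
  rw [one_mul, one_mul, show a * c * q ^ 2 * 1 * (b / c) = a * b * q ^ 2 by field_simp] at hI
  have e : qPoch q (a * q) j * qPoch q (c * q) j / qPoch q (a * b * q ^ 2) j =
      qBeta q a c (1 * q ^ j) (b / c) / qBeta q a c 1 (b / c) := by
    rw [div_eq_div_iff (h.qPoch_pos_of (h.ab_mul_pow_lt 0) j).ne' h.qBeta_pos.ne', hI]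
    ring
  rw [e]
  refine hasSum_of_eq hS (fun k => ?_) rfl
  have hx := node_mem h.q_pos h.q_lt h.a_pos h.c_neg k
  have p0 := h.adm_one.mul_lt_one hx
  have p1 := (h.qPochInf_pos_of p0).ne'
  have p2 := (h.qPochInf_pos_of (hA.mul_lt_one hx)).ne'
  have p3 := h.qBeta_pos.ne'
  rw [h.normFactor_sq]
  have e1 : 1 * q ^ j * node q a c k = node q a c k * q ^ j := by ring
  unfold qBetaWeight
  rw [e1] at p2 ⊢
  rw [one_mul, qPochInf_eq_mul h.q_pos h.q_lt _ j] at p1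
  rw [one_mul, qPochInf_eq_mul h.q_pos h.q_lt (node q a c k) j]
  have p4 := left_ne_zero_of_mul p1
  generalize qPoch q (node q a c k) j = X at *
  generalize qPochInf q (node q a c k * q ^ j) = Y at *
  generalize qPochInf q (b / c * node q a c k) = Z at *
  calc _ = (X / X) * (|node q a c k| * (qPochInf q (node q a c k / a) *
        qPochInf q (node q a c k / c) / (Y * Z)) / qBeta q a c 1 (b / c)) := by ring
    _ = _ := by rw [div_self p4, one_mul]

/-- The measure of `P_n` vanishes unless `n = 0`. -/
theorem hasSum_bigQJacobi (n : ℕ) :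
    HasSum (fun k => normFactor q a b c k ^ 2 * bigQJacobi q a b c n (node q a c k))
      (if n = 0 then 1 else 0) := by
  have e (k : ℕ ⊕ ℕ) : normFactor q a b c k ^ 2 * bigQJacobi q a b c n (node q a c k) =
      ∑ j ∈ Finset.range (n + 1), jacobiCoef q a b c n j *
        (normFactor q a b c k ^ 2 * qPoch q (node q a c k) j) := by
    rw [bigQJacobi_eq_sum h.q_pos n.lt_succ_self, Finset.mul_sum]
    exact Finset.sum_congr rfl fun j _ => by ring
  have hS := hasSum_sum (s := Finset.range (n + 1)) fun j _ =>
    (h.hasSum_qPoch j).mul_left (jacobiCoef q a b c n j)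
  refine hasSum_of_eq hS e ?_
  rcases n with _ | n
  · simp [jacobiCoef_zero_right, qPoch_zero]
  have hq := h.pow_pos (n + 1)
  have huv : (q ^ (n + 1))⁻¹ * (a * b * q ^ (n + 1 + 1)) * q = a * b * q ^ 2 := by
    field_simp
    ring
  -- The moments replace $(x;q)_j$ by $(aq,cq;q)_j/(abq^2;q)_j$, which makes the series balanced.
  -- Its sum contains $(q^{-n};q)_{n+1}=0$, the degree being $n+1$.
  have hV := sum_range_qPoch_balanced h.q_pos h.q_lt (u := (q ^ (n + 1))⁻¹)
    (v := a * b * q ^ (n + 1 + 1)) (huv ▸ h.ab_mul_pow_lt 0) (n + 1)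
  have hu : (q ^ (n + 1))⁻¹ * q = (q ^ n)⁻¹ := by
    have := h.q_pos.ne'
    rw [pow_succ]; field_simp
  rw [hu, qPoch_inv_pow_eq_zero h.q_pos n.lt_succ_self, huv, zero_mul, zero_div] at hV
  rw [if_neg n.succ_ne_zero, ← hV]
  refine Finset.sum_congr rfl fun j _ => ?_
  have := (h.qPoch_a_pos j).ne'
  have := (h.qPoch_c_pos j).ne'
  have := (h.qPoch_pos_of (h.ab_mul_pow_lt 0) j).ne'
  have := (h.qPoch_q_pos j).ne'
  unfold jacobiCoef
  rw [zero_add] at *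
  generalize qPoch q (a * q) j = X at *
  generalize qPoch q (c * q) j = Y at *
  generalize qPoch q (a * b * q ^ 2) j = Z at *
  generalize qPoch q q j = W at *
  generalize qPoch q (q ^ (n + 1))⁻¹ j = U at *
  field_simp

end Params

/-! ### Norms and orthogonality of all pairs. -/

theorem jacobiNorm_aux {X₁ X₂ X₃ X₄ X₅ Y₁ Y₂ R W A B C E Q P e g p : ℝ} (h₁ : X₁ ≠ 0)
    (h₂ : X₂ ≠ 0) (hR : R ≠ 0) :
    X₁ * X₂ * R / X₃ * (B * Y₁ * (E * X₅) * (Q * Y₂) / (W * R * X₄ * (A * X₁) * (C * X₂)) *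
      (P * p) * (e * g)) =
    p * g * (Y₂ * Y₁ * X₅ / (X₃ * X₄)) * (B * E * Q / (W * A * C) * P * e) := by
  calc _ = (X₁ / X₁) * (X₂ / X₂) * (R / R) * (p * g * (Y₂ * Y₁ * X₅ / (X₃ * X₄)) *
        (B * E * Q / (W * A * C) * P * e)) := by ring
    _ = _ := by rw [div_self h₁, div_self h₂, div_self hR, one_mul, one_mul, one_mul]

/-- The squared norm of `P_m`. -/
def jacobiNorm (q a b c : ℝ) (m : ℕ) : ℝ :=
  qPoch q (b * q) m * qPoch q (a * b * q / c) m * qPoch q q m /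
      (abWeight q a b m * qPoch q (a * q) m * qPoch q (c * q) m) *
    (-a * c) ^ m * q ^ (((m : ℝ) * (m + 3)) / 2)

theorem recDown_succ (q a b c : ℝ) (n : ℕ) : recDown q a b c (n + 1) = -a * c * q ^ (n + 2) *
    ((1 - q ^ (n + 1)) * (1 - b * q ^ (n + 1)) * (1 - a * b / c * q ^ (n + 1)) /
      ((1 - a * b * q ^ (2 * n + 2)) * (1 - a * b * q ^ (2 * n + 3)))) := by
  rw [recDown, show 2 * (n + 1) = 2 * n + 2 by ring]
  ring

theorem jacobiNorm_zero (q a b c : ℝ) : jacobiNorm q a b c 0 = 1 := by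
  simp [jacobiNorm, qPoch_zero, abWeight]

theorem abWeight_succ (m : ℕ) (hm : 1 - a * b * q ^ (2 * m + 1) ≠ 0 ∨ m = 0) :
    abWeight q a b (m + 1) =
      abWeight q a b m * abRatio q a b m * (1 - a * b * q ^ (2 * m + 3)) := by
  unfold abWeight abRatio
  rcases m with _ | m
  · simp [qPoch_zero]
  · have hm' := hm.resolve_right m.succ_ne_zero
    simp only [Nat.succ_ne_zero, if_false, Nat.add_sub_cancel]
    rw [qPoch_succ, show 2 * (m + 1 + 1) + 1 = 2 * (m + 1) + 3 by ring,
      show a * b * q ^ 2 * q ^ m = a * b * q ^ (m + 1 + 1) by ring, mul_assoc (qPoch _ _ _)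
        (1 - a * b * q ^ (2 * (m + 1) + 1)), mul_div_cancel₀ _ hm']

namespace Params

variable (h : Params q a b c)
include h

theorem abRatio_pos (n : ℕ) : 0 < abRatio q a b n := by
  unfold abRatio
  split_ifs with hn
  · exact one_pos
  · obtain ⟨m, rfl⟩ := Nat.exists_eq_succ_of_ne_zero hn
    exact div_pos (sub_pos.mpr (h.ab_mul_pow_lt m)) (sub_pos.mpr (h.ab_mul_pow_lt (2 * m + 1)))

theorem abWeight_succ' (m : ℕ) : abWeight q a b (m + 1) =
      abWeight q a b m * abRatio q a b m * (1 - a * b * q ^ (2 * m + 3)) := by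
  refine abWeight_succ m ?_
  rcases m with _ | m
  · exact Or.inr rfl
  · exact Or.inl (sub_pos.mpr (h.ab_mul_pow_lt (2 * m + 1))).ne'

theorem abWeight_pos (m : ℕ) : 0 < abWeight q a b m := by
  induction m with
  | zero => simp [abWeight]
  | succ m ih =>
    rw [h.abWeight_succ']
    exact mul_pos (mul_pos ih (h.abRatio_pos m)) (sub_pos.mpr (h.ab_mul_pow_lt (2 * m + 1)))

theorem neg_ac_pos : 0 < -a * c := by
  have := mul_neg_of_pos_of_neg h.a_pos h.c_neg
  linarith

theorem jacobiNorm_pos (m : ℕ) : 0 < jacobiNorm q a b c m :=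
  mul_pos (mul_pos (div_pos (mul_pos (mul_pos (h.qPoch_b_pos m) (h.qPoch_ab_div_c_pos m))
    (h.qPoch_q_pos m)) (mul_pos (mul_pos (h.abWeight_pos m) (h.qPoch_a_pos m)) (h.qPoch_c_pos m)))
    (_root_.pow_pos h.neg_ac_pos m)) (Real.rpow_pos_of_pos h.q_pos _)

theorem one_sub_c_pos (n : ℕ) : 0 < 1 - c * q ^ n := by linarith [h.c_mul_pow_neg n]

theorem one_sub_ab_div_c_pos (n : ℕ) : 0 < 1 - a * b / c * q ^ n := by
  linarith [mul_neg_of_neg_of_pos h.ab_div_c_neg (h.pow_pos n)]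

theorem one_sub_pow_pos (n : ℕ) : 0 < 1 - q ^ (n + 1) :=
  sub_pos.mpr (pow_lt_one₀ h.q_pos.le h.q_lt n.succ_ne_zero)

theorem recUp_pos (n : ℕ) : 0 < recUp q a b c n :=
  div_pos (mul_pos (mul_pos (sub_pos.mpr (h.a_mul_pow_lt n)) (h.one_sub_c_pos _))
    (h.abRatio_pos n)) (sub_pos.mpr (h.ab_mul_pow_lt (2 * n)))

theorem recDown_pos (n : ℕ) : 0 < recDown q a b c (n + 1) := by
  rw [recDown_succ]
  exact mul_pos (mul_pos h.neg_ac_pos (h.pow_pos _)) (div_pos (mul_pos (mul_pos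
    (h.one_sub_pow_pos n) (sub_pos.mpr (h.b_mul_pow_lt n))) (h.one_sub_ab_div_c_pos _))
    (mul_pos (sub_pos.mpr (h.ab_mul_pow_lt (2 * n))) (sub_pos.mpr (h.ab_mul_pow_lt (2 * n + 1)))))

/-- This compatibility lets the norms symmetrize the recurrence. The power of $q$ matches because
$\frac{(m+1)(m+4)}2-\frac{m(m+3)}2=m+2$. -/
theorem recUp_mul_jacobiNorm (m : ℕ) :
    recUp q a b c m * jacobiNorm q a b c (m + 1) =
      recDown q a b c (m + 1) * jacobiNorm q a b c m := by
  have r : q ^ ((((m + 1 : ℕ) : ℝ) * ((m + 1 : ℕ) + 3)) / 2) =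
      q ^ (((m : ℝ) * (m + 3)) / 2) * q ^ (m + 2) := by
    rw [← Real.rpow_natCast q (m + 2), ← Real.rpow_add h.q_pos]
    push_cast
    ring_nf
  rw [recDown_succ, recUp, jacobiNorm, jacobiNorm, r, h.abWeight_succ']
  simp only [qPoch_succ]
  rw [show a * q * q ^ m = a * q ^ (m + 1) by ring, show b * q * q ^ m = b * q ^ (m + 1) by ring,
    show c * q * q ^ m = c * q ^ (m + 1) by ring, show q * q ^ m = q ^ (m + 1) by ring,
    show a * b * q / c * q ^ m = a * b / c * q ^ (m + 1) by ring, pow_succ (-a * c) m]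
  have n1 := (sub_pos.mpr (h.a_mul_pow_lt m)).ne'
  have n2 := (h.one_sub_c_pos (m + 1)).ne'
  exact jacobiNorm_aux n1 n2 (h.abRatio_pos m).ne'

/-- Orthogonality of the big `q`-Jacobi polynomials. -/
theorem hasSum_bigQJacobi_mul (m n : ℕ) :
    HasSum (fun k => normFactor q a b c k ^ 2 * (bigQJacobi q a b c m (node q a c k) *
      bigQJacobi q a b c n (node q a c k))) (if m = n then jacobiNorm q a b c m else 0) := by
  induction m using Nat.strong_induction_on generalizing n with
  | _ m ih =>
  rcases m with _ | m
  · refine hasSum_of_eq (h.hasSum_bigQJacobi n) (fun k => ?_) ?_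
    · simp only [bigQJacobi_zero h.q_pos, one_mul]
    · simp [jacobiNorm_zero, eq_comm]
  have hA := (h.recUp_pos m).ne'
  -- Multiplication by $x$ is applied to $P_n$, so only row $m$ is needed. The last condition reads
  -- $n=m+1$ so that it makes sense without a predecessor of $n=0$.
  have hx : HasSum (fun k => normFactor q a b c k ^ 2 * (bigQJacobi q a b c m (node q a c k) *
      (node q a c k * bigQJacobi q a b c n (node q a c k))))
      (recUp q a b c n * (if m = n + 1 then jacobiNorm q a b c m else 0) -
        coeffB q a b c n * (if m = n then jacobiNorm q a b c m else 0) +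
        if n = m + 1 then recDown q a b c n * jacobiNorm q a b c m else 0) := by
    rcases n with _ | n
    · refine hasSum_of_eq (((ih m (by lia) 1).mul_left (recUp q a b c 0)).sub
        ((ih m (by lia) 0).mul_left (coeffB q a b c 0))) (fun k => ?_) ?_
      · rw [h.bigQJacobi_recurrence_zero]; ring
      · simp
    · refine hasSum_of_eq ((((ih m (by lia) (n + 2)).mul_left (recUp q a b c (n + 1))).sub
        ((ih m (by lia) (n + 1)).mul_left (coeffB q a b c (n + 1)))).add
        ((ih m (by lia) n).mul_left (recDown q a b c (n + 1)))) (fun k => ?_) ?_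
      · rw [h.bigQJacobi_recurrence_succ]; ring
      · simp [eq_comm]
  -- The recurrence solved for $P_{m+1}$. Nonzero terms occur only for $n$ at distance at most $1$
  -- from the old index; the two outer cases cancel or survive by `recUp_mul_jacobiNorm`.
  have hfin : HasSum (fun k => recUp q a b c m * (normFactor q a b c k ^ 2 *
      (bigQJacobi q a b c (m + 1) (node q a c k) * bigQJacobi q a b c n (node q a c k))))
      (recUp q a b c m * if m + 1 = n then jacobiNorm q a b c (m + 1) else 0) := by
    rcases m with _ | m
    · refine hasSum_of_eq (hx.add ((ih 0 (by lia) n).mul_left (coeffB q a b c 0))) (fun k => ?_) ?_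
      · linear_combination (-normFactor q a b c k ^ 2 * bigQJacobi q a b c n (node q a c k)) *
          h.bigQJacobi_recurrence_zero (node q a c k)
      · have := h.recUp_mul_jacobiNorm 0
        rcases n with _ | _ | n <;> simp_all
    · refine hasSum_of_eq ((hx.add ((ih (m + 1) (by lia) n).mul_left (coeffB q a b c (m + 1)))).sub
        ((ih m (by lia) n).mul_left (recDown q a b c (m + 1)))) (fun k => ?_) ?_
      · linear_combination (-normFactor q a b c k ^ 2 * bigQJacobi q a b c n (node q a c k)) *
          h.bigQJacobi_recurrence_succ m (node q a c k)
      · have h1 := h.recUp_mul_jacobiNorm m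
        have h2 := h.recUp_mul_jacobiNorm (m + 1)
        by_cases c1 : n = m
        · subst c1; simp [show ¬ n + 1 + 1 = n by lia, show ¬ n = n + 1 + 1 by lia]; linarith
        by_cases c2 : n = m + 1
        · subst c2; simp
        by_cases c3 : n = m + 2
        · subst c3; simp; linarith
        have d1 : m ≠ n := Ne.symm c1
        have d2 : m + 1 ≠ n := Ne.symm c2
        have d3 : m + 1 + 1 ≠ n := Ne.symm c3
        have d4 : n ≠ m + 1 + 1 := c3
        simp [d1, d2, d3, d4]
  refine hasSum_of_eq (hfin.div_const (recUp q a b c m)) (fun k => ?_) ?_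
  · rw [mul_div_cancel_left₀ _ hA]
  · rw [mul_div_cancel_left₀ _ hA]

end Params

end BigQJacobi
end

noncomputable section

namespace BigQJacobi

open Filter Topology

/-! ### Operators that are diagonal in a Hilbert basis -/

section Diagonal

variable {ι E : Type*} [NormedAddCommGroup E] [InnerProductSpace ℂ E]
  {e : HilbertBasis ι ℂ E} {S T : E →L[ℂ] E} {z w : ι → ℂ} {x : ι → ℝ}

/-- `T` multiplies the `k`-th basis vector by `z k`. -/
def IsDiagonal (e : HilbertBasis ι ℂ E) (T : E →L[ℂ] E) (z : ι → ℂ) : Prop :=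
  ∀ v k, e.repr (T v) k = z k * e.repr v k

theorem exists_isDiagonal (e : HilbertBasis ι ℂ E) {C : ℝ} (hz : ∀ k, ‖z k‖ ≤ C) :
    ∃ T : E →L[ℂ] E, IsDiagonal e T z := by
  have hm (f : lp (fun _ : ι => ℂ) 2) : Memℓp (fun k => z k * f k) 2 := by
    refine ((lp.memℓp f).norm.const_mul C).mono fun k => ?_
    rw [norm_mul]
    exact mul_le_mul_of_nonneg_right (hz k) (norm_nonneg _)
  let M : lp (fun _ : ι => ℂ) 2 →ₗ[ℂ] lp (fun _ : ι => ℂ) 2 :=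
    { toFun := fun f => ⟨fun k => z k * f k, hm f⟩
      map_add' := fun f g => by
        ext k
        exact mul_add (z k) (f k) (g k)
      map_smul' := fun t f => by
        ext k
        exact mul_left_comm (z k) t (f k) }
  have hM : ∀ f, ‖M f‖ ≤ |C| * ‖f‖ := fun f => by
    have h1 : ‖M f‖ ≤ ‖(C : ℂ) • f‖ := by
      refine lp.norm_mono two_ne_zero fun k => ?_
      change ‖z k * f k‖ ≤ ‖(C : ℂ) * f k‖
      rw [norm_mul, norm_mul, Complex.norm_real]
      exact mul_le_mul_of_nonneg_right ((hz k).trans (Real.le_norm_self C)) (norm_nonneg _)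
    rwa [norm_smul, Complex.norm_real, Real.norm_eq_abs] at h1
  refine ⟨(e.repr.symm.toContinuousLinearEquiv : lp (fun _ : ι => ℂ) 2 →L[ℂ] E) ∘L
    M.mkContinuous |C| hM ∘L (e.repr.toContinuousLinearEquiv : E →L[ℂ] _), fun v k => ?_⟩
  simp [M]

theorem repr_ext (e : HilbertBasis ι ℂ E) {v w : E} (h : ∀ k, e.repr v k = e.repr w k) : v = w :=
  e.repr.injective (lp.ext (funext h))

namespace IsDiagonal

theorem unique (hS : IsDiagonal e S z) (hT : IsDiagonal e T z) : S = T :=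
  ContinuousLinearMap.ext fun v => repr_ext e fun k => (hS v k).trans (hT v k).symm

theorem one : IsDiagonal e 1 fun _ => 1 := fun _ _ => (one_mul _).symm

theorem mul (hS : IsDiagonal e S z) (hT : IsDiagonal e T w) :
    IsDiagonal e (S * T) fun k => z k * w k := fun v k => by
  exact (hS (T v) k).trans (by rw [hT, mul_assoc])

theorem algebraMap_sub (hT : IsDiagonal e T z) (t : ℂ) :
    IsDiagonal e (algebraMap ℂ (E →L[ℂ] E) t - T) fun k => t - z k := fun v k => by
  have h1 : (algebraMap ℂ (E →L[ℂ] E) t - T) v = t • v - T v := by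
    rw [Algebra.algebraMap_eq_smul_one]; rfl
  rw [h1, map_sub, map_smul, lp.coeFn_sub, Pi.sub_apply, hT, lp.coeFn_smul, Pi.smul_apply,
    smul_eq_mul, sub_mul]

theorem apply_eq_smul_iff (hT : IsDiagonal e T z) {v : E} {t : ℂ} :
    T v = t • v ↔ ∀ k, z k = t ∨ e.repr v k = 0 := by
  constructor
  · intro h k
    have h1 := hT v k
    rw [h, map_smul, lp.coeFn_smul, Pi.smul_apply, smul_eq_mul] at h1
    exact (mul_eq_mul_right_iff.mp h1).imp_left Eq.symm
  · intro h
    refine repr_ext e fun k => ?_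
    rw [hT, map_smul, lp.coeFn_smul, Pi.smul_apply, smul_eq_mul]
    rcases h k with h | h <;> simp [h]

theorem apply_basis (hT : IsDiagonal e T z) (k : ι) : T (e k) = z k • e k := by
  classical
  refine hT.apply_eq_smul_iff.mpr fun j => ?_
  rcases eq_or_ne j k with rfl | hj
  · exact Or.inl rfl
  · right
    rw [e.repr_self]
    exact lp.single_apply_ne 2 k _ hj

theorem eigenspace_eq (hT : IsDiagonal e T z) (hz : Function.Injective z) (k : ι) :
    Module.End.eigenspace (T : Module.End ℂ E) (z k) = Submodule.span ℂ {e k} := by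
  classical
  ext v
  rw [Module.End.mem_eigenspace_iff, Submodule.mem_span_singleton]
  refine Iff.trans hT.apply_eq_smul_iff ⟨fun h => ⟨e.repr v k, ?_⟩, ?_⟩
  · refine repr_ext e fun j => ?_
    rw [map_smul, e.repr_self, lp.coeFn_smul, Pi.smul_apply]
    rcases eq_or_ne j k with rfl | hj
    · rw [lp.single_apply_self, smul_eq_mul, mul_one]
    · rw [lp.single_apply_ne 2 k _ hj, smul_zero]
      exact ((h j).resolve_left fun h' => hj (hz h')).symm
  · rintro ⟨t, rfl⟩
    refine hT.apply_eq_smul_iff.mp ?_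
    rw [map_smul, hT.apply_basis, smul_comm]

theorem hasEigenvalue_iff (hT : IsDiagonal e T z) {t : ℂ} :
    Module.End.HasEigenvalue (T : Module.End ℂ E) t ↔ ∃ k, t = z k := by
  constructor
  · intro h
    obtain ⟨v, hv, hv0⟩ := h.exists_hasEigenvector
    rw [Module.End.mem_eigenspace_iff] at hv
    by_contra! hne
    refine hv0 (repr_ext e fun k => ?_)
    rw [((hT.apply_eq_smul_iff.mp hv) k).resolve_left (hne k).symm]
    simp
  · rintro ⟨k, rfl⟩
    exact Module.End.hasEigenvalue_of_hasEigenvector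
      ⟨Module.End.mem_eigenspace_iff.mpr (hT.apply_basis k), e.orthonormal.ne_zero k⟩

theorem inner_left (hT : IsDiagonal e T z) (v w : E) :
    inner ℂ (T v) w = ∑' k, inner ℂ (z k * e.repr v k) (e.repr w k) := by
  rw [← e.repr.inner_map_map, lp.inner_eq_tsum]
  simp only [hT v]

theorem isSymmetric (hT : IsDiagonal e T fun k => (x k : ℂ)) :
    (T : E →ₗ[ℂ] E).IsSymmetric := by
  intro v w
  change inner ℂ (T v) w = inner ℂ v (T w)
  rw [hT.inner_left, ← inner_conj_symm v (T w), hT.inner_left, Complex.conj_tsum]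
  refine tsum_congr fun k => ?_
  simp only [RCLike.inner_apply, map_mul, Complex.conj_conj, Complex.conj_ofReal]
  ring

theorem isPositive (hT : IsDiagonal e T fun k => (x k : ℂ)) (hx : ∀ k, 0 ≤ x k) :
    T.IsPositive := by
  refine ⟨hT.isSymmetric, fun v => ?_⟩
  change 0 ≤ (inner ℂ (T v) v).re
  rw [hT.inner_left]
  have h (k : ι) : inner ℂ ((x k : ℂ) * e.repr v k) (e.repr v k) =
      ((x k * ‖e.repr v k‖ ^ 2 : ℝ) : ℂ) := by
    rw [RCLike.inner_apply, map_mul, Complex.conj_ofReal, mul_left_comm, Complex.mul_conj,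
      Complex.normSq_eq_norm_sq]
    push_cast
    rfl
  rw [tsum_congr h, ← Complex.ofReal_tsum, Complex.ofReal_re]
  exact tsum_nonneg fun k => mul_nonneg (hx k) (sq_nonneg _)

variable [CompleteSpace E]

theorem isSelfAdjoint (hT : IsDiagonal e T fun k => (x k : ℂ)) : IsSelfAdjoint T :=
  ContinuousLinearMap.isSelfAdjoint_iff_isSymmetric.mpr hT.isSymmetric

theorem spectrum_eq [Infinite ι] (hT : IsDiagonal e T z) (hz : Tendsto z cofinite (𝓝 0)) :
    spectrum ℂ T = insert 0 (Set.range z) := by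
  refine Set.Subset.antisymm (fun t ht => ?_) ?_
  · by_contra hne
    -- A sequence tending to $0$ together with $0$ is compact. A point outside has positive distance
    -- $\varepsilon$, so the diagonal inverse has entries bounded by $\varepsilon^{-1}$.
    have hcl : IsClosed (insert 0 (Set.range z)) := hz.isCompact_insert_range_of_cofinite.isClosed
    obtain ⟨ε, hε, hball⟩ := Metric.isOpen_iff.mp hcl.isOpen_compl t hne
    have hfar (k : ι) : ε ≤ ‖t - z k‖ := by
      by_contra! hlt
      refine hball (a := z k) ?_ (Set.mem_insert_of_mem _ ⟨k, rfl⟩)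
      rwa [Metric.mem_ball, dist_comm, dist_eq_norm]
    have hne0 (k : ι) : t - z k ≠ 0 := norm_pos_iff.mp (hε.trans_le (hfar k))
    obtain ⟨R, hR⟩ := exists_isDiagonal e (z := fun k => (t - z k)⁻¹) (C := ε⁻¹) fun k => by
      rw [norm_inv]
      exact inv_anti₀ hε (hfar k)
    refine ht ?_
    have h1 : (algebraMap ℂ (E →L[ℂ] E) t - T) * R = 1 := by
      refine IsDiagonal.unique ((hT.algebraMap_sub t).mul hR) ?_
      simpa only [mul_inv_cancel₀ (hne0 _)] using IsDiagonal.one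
    have h2 : R * (algebraMap ℂ (E →L[ℂ] E) t - T) = 1 := by
      refine IsDiagonal.unique (hR.mul (hT.algebraMap_sub t)) ?_
      simpa only [inv_mul_cancel₀ (hne0 _)] using IsDiagonal.one
    exact ⟨⟨_, R, h1, h2⟩, rfl⟩
  · have hmem (k : ι) : z k ∈ spectrum ℂ T := by
      intro hu
      obtain ⟨u, hu⟩ := hu
      have h0 : (algebraMap ℂ (E →L[ℂ] E) (z k) - T) (e k) = 0 := by
        have h1 : (algebraMap ℂ (E →L[ℂ] E) (z k) - T) (e k) = z k • e k - T (e k) := by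
          rw [Algebra.algebraMap_eq_smul_one]; rfl
        rw [h1, hT.apply_basis, sub_self]
      have h2 : (↑u⁻¹ : E →L[ℂ] E) ((u : E →L[ℂ] E) (e k)) = e k :=
        congrArg (fun S : E →L[ℂ] E => S (e k)) u.inv_mul
      rw [hu, h0, map_zero] at h2
      exact e.orthonormal.ne_zero k h2.symm
    rintro t (rfl | ⟨k, rfl⟩)
    -- Since the index set is infinite, $0$ is a limit of eigenvalues and lies in the closed
    -- spectrum.
    · exact (spectrum.isClosed T).mem_of_tendsto hz (Eventually.of_forall hmem)
    · exact hmem k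

end IsDiagonal

/-- A Hilbert basis indexed along a bijection. -/
theorem exists_hilbertBasis_comp {κ : Type*} (e : HilbertBasis ι ℂ E) [CompleteSpace E]
    (σ : κ ≃ ι) : ∃ f : HilbertBasis κ ℂ E, ∀ k, f k = e (σ k) := by
  refine ⟨HilbertBasis.mk (e.orthonormal.comp σ σ.injective) ?_, fun k => ?_⟩
  · rw [σ.surjective.range_comp, e.dense_span]
  · rw [HilbertBasis.coe_mk]; rfl

end Diagonal

/-- Only finitely many terms lie outside any disc about $0$, while every such disc contains a term,
and no term is $0$. -/
theorem accPt_insert_range_iff {ι : Type*} [Infinite ι] {z : ι → ℂ}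
    (hz : Tendsto z cofinite (𝓝 0)) (h0 : ∀ k, z k ≠ 0) (t : ℂ) :
    AccPt t (𝓟 (insert 0 (Set.range z))) ↔ t = 0 := by
  constructor
  · intro h
    by_contra ht
    have hpos : 0 < ‖t‖ / 2 := half_pos (norm_pos_iff.mpr ht)
    have hU : (Metric.closedBall (0 : ℂ) (‖t‖ / 2))ᶜ ∈ 𝓝 t := by
      refine Metric.isClosed_closedBall.isOpen_compl.mem_nhds ?_
      simp only [Set.mem_compl_iff, Metric.mem_closedBall, dist_zero_right, not_le]
      linarith
    refine Set.Infinite.of_accPt (h.nhds_inter hU) ?_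
    have hfin : {k | z k ∉ Metric.closedBall (0 : ℂ) (‖t‖ / 2)}.Finite :=
      hz (Metric.closedBall_mem_nhds 0 hpos)
    refine (hfin.image z).subset ?_
    rintro y ⟨hy, rfl | ⟨k, rfl⟩⟩
    · exact absurd (Metric.mem_closedBall_self hpos.le) hy
    · exact ⟨k, hy, rfl⟩
  · rintro rfl
    rw [accPt_iff_nhds]
    intro U hU
    obtain ⟨k, hk⟩ := (hz.eventually hU).exists
    exact ⟨z k, ⟨hk, Set.mem_insert_of_mem _ ⟨k, rfl⟩⟩, h0 k⟩

/-! ### Determinacy of the moment problem on a bounded interval -/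

/-- By the Weierstrass theorem the measure annihilates all continuous functions. Tents of height $1$
shrinking to $x_{k_0}$ then isolate the mass there by dominated convergence, even if other points
accumulate at $x_{k_0}$. -/
theorem eq_zero_of_moments {ι : Type*} {ν : ι → ℂ} {x : ι → ℝ} {A B : ℝ}
    (hν : Summable fun k => ‖ν k‖) (hx : Function.Injective x) (hb : ∀ k, x k ∈ Set.Icc A B)
    (hm : ∀ j : ℕ, ∑' k, ν k * (x k : ℂ) ^ j = 0) (k₀ : ι) : ν k₀ = 0 := by
  classical
  have hcont (f : ℝ → ℝ) (hf : Continuous f) : ∑' k, ν k * (f (x k) : ℂ) = 0 := by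
    have hbd {g : ℝ → ℝ} {C : ℝ} (hg : ∀ k, |g (x k)| ≤ C) :
        Summable fun k => ν k * (g (x k) : ℂ) := by
      refine Summable.of_norm_bounded (hν.mul_right C) fun k => ?_
      rw [norm_mul, Complex.norm_real]
      exact mul_le_mul_of_nonneg_left (hg k) (norm_nonneg _)
    have hcb (g : ℝ → ℝ) (hg : Continuous g) : ∃ C, ∀ k, |g (x k)| ≤ C := by
      obtain ⟨C, hC⟩ := isCompact_Icc.exists_bound_of_continuousOn (hg.continuousOn (s := Set.Icc A B))
      exact ⟨C, fun k => hC _ (hb k)⟩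
    have hpoly (p : Polynomial ℝ) : ∑' k, ν k * ((p.eval (x k) : ℝ) : ℂ) = 0 := by
      have hS (j : ℕ) : Summable fun k => (p.coeff j : ℂ) * (ν k * (x k : ℂ) ^ j) := by
        obtain ⟨C, hC⟩ := hcb (fun y => y ^ j) (continuous_pow j)
        refine ((hbd (g := fun y => y ^ j) hC).mul_left (p.coeff j : ℂ)).congr fun k => ?_
        rw [← Complex.ofReal_pow]
      have he (k : ι) : ν k * ((p.eval (x k) : ℝ) : ℂ) =
          ∑ j ∈ Finset.range (p.natDegree + 1), (p.coeff j : ℂ) * (ν k * (x k : ℂ) ^ j) := by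
        rw [Polynomial.eval_eq_sum_range]
        push_cast
        rw [Finset.mul_sum]
        exact Finset.sum_congr rfl fun j _ => by ring
      rw [tsum_congr he, Summable.tsum_finsetSum fun j _ => hS j]
      refine Finset.sum_eq_zero fun j _ => ?_
      rw [tsum_mul_left, hm, mul_zero]
    rw [← norm_le_zero_iff]
    refine le_of_forall_pos_le_add fun δ hδ => ?_
    set N := ∑' k, ‖ν k‖
    have hN : 0 ≤ N := tsum_nonneg fun k => norm_nonneg _
    -- The tolerance has $N+1$ in place of the total mass $N$, which may be $0$.
    obtain ⟨p, hp⟩ := exists_polynomial_near_of_continuousOn A B f hf.continuousOn (δ / (N + 1))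
      (by positivity)
    obtain ⟨C₁, hC₁⟩ := hcb f hf
    obtain ⟨C₂, hC₂⟩ := hcb (fun y => p.eval y) p.continuous
    have hd : ∑' k, ν k * (f (x k) : ℂ) =
        ∑' k, ν k * ((f (x k) - p.eval (x k) : ℝ) : ℂ) := by
      have := (hbd hC₁).tsum_sub (hbd (g := fun y => p.eval y) hC₂)
      rw [hpoly, sub_zero] at this
      rw [← this]
      refine tsum_congr fun k => ?_
      push_cast
      ring
    rw [hd, zero_add]
    calc ‖∑' k, ν k * ((f (x k) - p.eval (x k) : ℝ) : ℂ)‖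
        ≤ N * (δ / (N + 1)) := by
          refine tsum_of_norm_bounded (hν.hasSum.mul_right _) fun k => ?_
          rw [norm_mul, Complex.norm_real, Real.norm_eq_abs, abs_sub_comm]
          exact mul_le_mul_of_nonneg_left (hp _ (hb k)).le (norm_nonneg _)
      _ ≤ δ := by
          rw [mul_div_assoc', div_le_iff₀ (by positivity)]
          nlinarith
  have hlim : Tendsto (fun n : ℕ => ∑' k, ν k * ((max 0 (1 - n * |x k - x k₀|) : ℝ) : ℂ)) atTop
      (𝓝 (∑' k, if k = k₀ then ν k₀ else 0)) := by
    refine tendsto_tsum_of_dominated_convergence hν (fun k => ?_)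
      (Eventually.of_forall fun n k => ?_)
    · rcases eq_or_ne k k₀ with rfl | hk
      · simp
      · rw [if_neg hk]
        have hpos : 0 < |x k - x k₀| := abs_pos.mpr (sub_ne_zero.mpr fun h => hk (hx h))
        obtain ⟨n₀, hn₀⟩ := exists_nat_ge (1 / |x k - x k₀|)
        refine tendsto_const_nhds.congr' ?_
        filter_upwards [eventually_ge_atTop n₀] with n hn
        have h1 : 1 ≤ n * |x k - x k₀| := by
          rw [div_le_iff₀ hpos] at hn₀
          refine hn₀.trans (mul_le_mul_of_nonneg_right (by exact_mod_cast hn) hpos.le)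
        rw [max_eq_left (by linarith)]
        simp
    · rw [norm_mul, Complex.norm_real, Real.norm_eq_abs]
      refine mul_le_of_le_one_right (norm_nonneg _) ?_
      rw [abs_of_nonneg (le_max_left _ _)]
      refine max_le zero_le_one ?_
      have : 0 ≤ (n : ℝ) * |x k - x k₀| := by positivity
      linarith
  rw [tsum_ite_eq] at hlim
  refine tendsto_nhds_unique hlim (tendsto_const_nhds.congr fun n => ?_)
  exact (hcont (fun y => max 0 (1 - n * |y - x k₀|)) (by fun_prop)).symm

end BigQJacobi
end

noncomputable section

namespace BigQJacobi

open Filter Topology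

variable {q a b c : ℝ}

/-! ### The orthogonal matrix -/

namespace Params

variable (h : Params q a b c)
include h

theorem beta_eq (m : ℕ) (x : ℝ) :
    beta q a b c m x = (Real.sqrt (jacobiNorm q a b c m))⁻¹ * bigQJacobi q a b c m x := by
  unfold beta jacobiNorm
  congr 1
  have hE : q ^ (-((m : ℝ) * (m + 3)) / 4) = Real.sqrt (q ^ (((m : ℝ) * (m + 3)) / 2))⁻¹ := by
    rw [← Real.rpow_neg h.q_pos.le, Real.sqrt_eq_rpow, ← Real.rpow_mul h.q_pos.le]
    ring_nf
  have hp : 0 ≤ (q ^ (((m : ℝ) * (m + 3)) / 2))⁻¹ :=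
    (inv_pos.mpr (Real.rpow_pos_of_pos h.q_pos _)).le
  rw [hE, ← Real.sqrt_mul' _ hp, ← Real.sqrt_inv]
  congr 1
  simp only [mul_inv, inv_div]
  rw [mul_div_assoc, mul_div_assoc, mul_div_assoc]
  ring

/-- The geometric mean of the two outer recurrence coefficients is the entry of the symmetrized
matrix. -/
theorem jacobiOff_sq (n : ℕ) :
    jacobiOff q a b c n ^ 2 = recUp q a b c n * recDown q a b c (n + 1) := by
  have h1 : 0 ≤ -a * c * q ^ (n + 2) := (mul_pos h.neg_ac_pos (h.pow_pos _)).le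
  have h2 : 0 ≤ (1 - q ^ (n + 1)) * (1 - a * q ^ (n + 1)) * (1 - b * q ^ (n + 1)) *
      (1 - c * q ^ (n + 1)) * (1 - a * b / c * q ^ (n + 1)) *
      abRatio q a b n / (1 - a * b * q ^ (2 * n + 3)) :=
    (div_pos (mul_pos (mul_pos (mul_pos (mul_pos (mul_pos (h.one_sub_pow_pos n)
      (sub_pos.mpr (h.a_mul_pow_lt n))) (sub_pos.mpr (h.b_mul_pow_lt n))) (h.one_sub_c_pos _))
      (h.one_sub_ab_div_c_pos _)) (h.abRatio_pos n))
      (sub_pos.mpr (h.ab_mul_pow_lt (2 * n + 1)))).le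
  rw [jacobiOff, div_pow, mul_pow, Real.sq_sqrt h1, Real.sq_sqrt h2, recDown_succ, recUp]
  generalize 1 - a * b * q ^ (2 * n + 2) = X
  generalize 1 - a * b * q ^ (2 * n + 3) = Y
  generalize 1 - a * q ^ (n + 1) = Z
  generalize 1 - c * q ^ (n + 1) = W
  ring

theorem jacobiOff_pos (n : ℕ) : 0 < jacobiOff q a b c n := by
  refine lt_of_le_of_ne ?_ fun h0 => ?_
  · exact div_nonneg (mul_nonneg (Real.sqrt_nonneg _) (Real.sqrt_nonneg _))
      (sub_pos.mpr (h.ab_mul_pow_lt (2 * n))).le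
  · have h1 := h.jacobiOff_sq n
    rw [← h0] at h1
    have h2 := mul_pos (h.recUp_pos n) (h.recDown_pos n)
    simp at h1
    rcases h1 with h1 | h1 <;> simp [h1] at h2

theorem jacobiOff_mul_sqrt (n : ℕ) :
    jacobiOff q a b c n * Real.sqrt (jacobiNorm q a b c n) =
      recUp q a b c n * Real.sqrt (jacobiNorm q a b c (n + 1)) := by
  have p0 := h.jacobiNorm_pos n
  have p1 := h.jacobiNorm_pos (n + 1)
  rw [← sq_eq_sq₀ (mul_nonneg (h.jacobiOff_pos n).le (Real.sqrt_nonneg _))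
    (mul_nonneg (h.recUp_pos n).le (Real.sqrt_nonneg _)), mul_pow, mul_pow, Real.sq_sqrt p0.le,
    Real.sq_sqrt p1.le, h.jacobiOff_sq]
  linear_combination (-recUp q a b c n) * h.recUp_mul_jacobiNorm n

theorem recUp_mul_inv_sqrt (n : ℕ) :
    recUp q a b c n * (Real.sqrt (jacobiNorm q a b c n))⁻¹ =
      jacobiOff q a b c n * (Real.sqrt (jacobiNorm q a b c (n + 1)))⁻¹ := by
  have p0 := (Real.sqrt_pos.mpr (h.jacobiNorm_pos n)).ne'
  have p1 := (Real.sqrt_pos.mpr (h.jacobiNorm_pos (n + 1))).ne'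
  rw [← div_eq_mul_inv, ← div_eq_mul_inv, div_eq_div_iff p0 p1, h.jacobiOff_mul_sqrt]

theorem recDown_mul_inv_sqrt (n : ℕ) :
    recDown q a b c (n + 1) * (Real.sqrt (jacobiNorm q a b c (n + 1)))⁻¹ =
      jacobiOff q a b c n * (Real.sqrt (jacobiNorm q a b c n))⁻¹ := by
  refine mul_left_cancel₀ (h.recUp_pos n).ne' ?_
  rw [← mul_assoc, ← h.jacobiOff_sq, mul_left_comm, h.recUp_mul_inv_sqrt]
  ring

theorem mul_beta_zero (x : ℝ) :
    x * beta q a b c 0 x =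
      jacobiOff q a b c 0 * beta q a b c 1 x - coeffB q a b c 0 * beta q a b c 0 x := by
  simp only [h.beta_eq]
  rw [← mul_assoc (jacobiOff _ _ _ _ _), ← h.recUp_mul_inv_sqrt 0]
  linear_combination (Real.sqrt (jacobiNorm q a b c 0))⁻¹ * h.bigQJacobi_recurrence_zero x

theorem mul_beta_succ (n : ℕ) (x : ℝ) :
    x * beta q a b c (n + 1) x =
      jacobiOff q a b c (n + 1) * beta q a b c (n + 2) x +
        jacobiOff q a b c n * beta q a b c n x -
        coeffB q a b c (n + 1) * beta q a b c (n + 1) x := by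
  simp only [h.beta_eq]
  rw [← mul_assoc (jacobiOff _ _ _ _ _), ← mul_assoc (jacobiOff _ _ _ _ _),
    ← h.recUp_mul_inv_sqrt (n + 1), ← h.recDown_mul_inv_sqrt n]
  linear_combination (Real.sqrt (jacobiNorm q a b c (n + 1)))⁻¹ *
    h.bigQJacobi_recurrence_succ n x

theorem hasSum_Mhat_mul (m m' : ℕ) :
    HasSum (fun k => Mhat q a b c m k * Mhat q a b c m' k) (if m = m' then 1 else 0) := by
  refine hasSum_of_eq ((h.hasSum_bigQJacobi_mul m m').mul_left
    ((Real.sqrt (jacobiNorm q a b c m))⁻¹ * (Real.sqrt (jacobiNorm q a b c m'))⁻¹))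
    (fun k => ?_) ?_
  · simp only [Mhat, h.beta_eq]
    ring
  · split_ifs with hm
    · subst hm
      rw [← mul_inv, Real.mul_self_sqrt (h.jacobiNorm_pos m).le,
        inv_mul_cancel₀ (h.jacobiNorm_pos m).ne']
    · rw [mul_zero]

theorem node_injective : Function.Injective (node q a c) := by
  have hinj {y : ℝ} (hy : y ≠ 0) {n m : ℕ} (e : y * q ^ (n + 1) = y * q ^ (m + 1)) : n = m := by
    have := pow_right_injective₀ h.q_pos h.q_lt.ne (mul_left_cancel₀ hy e)
    lia
  rintro (n | n) (m | m) e
  · exact congrArg _ (hinj h.a_pos.ne' e)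
  · have h1 := node_inl_pos (c := c) h.q_pos h.a_pos n
    rw [e] at h1
    exact absurd h1 (node_inr_neg h.q_pos h.c_neg m).not_gt
  · have h1 := node_inl_pos (c := c) h.q_pos h.a_pos m
    rw [← e] at h1
    exact absurd h1 (node_inr_neg h.q_pos h.c_neg n).not_gt
  · exact congrArg _ (hinj h.c_neg.ne e)

theorem node_ne_zero (k : ℕ ⊕ ℕ) : node q a c k ≠ 0 := by
  rcases k with n | n
  · exact (node_inl_pos h.q_pos h.a_pos n).ne'
  · exact (node_inr_neg h.q_pos h.c_neg n).ne

/-- The rows of the matrix `Mhat` as square-summable sequences. -/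
theorem exists_row (m : ℕ) : ∃ v : lp (fun _ : ℕ ⊕ ℕ => ℂ) 2,
    ∀ k, v k = (Mhat q a b c m k : ℂ) := by
  refine ⟨⟨fun k => (Mhat q a b c m k : ℂ), memℓp_gen ?_⟩, fun k => rfl⟩
  refine (h.hasSum_Mhat_mul m m).summable.congr fun k => ?_
  simp [Complex.norm_real, sq]

theorem summable_normFactor_sq : Summable fun k => normFactor q a b c k ^ 2 := by
  simpa [qPoch_zero] using (h.hasSum_qPoch 0).summable

/-- The polynomials are dense in the `L²` space of the orthogonality measure. -/
theorem eq_zero_of_orthogonal {g : lp (fun _ : ℕ ⊕ ℕ => ℂ) 2}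
    (hg : ∀ m, ∑' k, (Mhat q a b c m k : ℂ) * g k = 0) : g = 0 := by
  have hsq : Summable fun k => ‖g k‖ ^ 2 := by simpa using (lp.memℓp g).summable (by simp)
  have hν : Summable fun k => ‖(normFactor q a b c k : ℂ) * g k‖ := by
    refine Summable.of_nonneg_of_le (fun k => norm_nonneg _) (fun k => ?_)
      (h.summable_normFactor_sq.add hsq)
    rw [norm_mul, Complex.norm_real, Real.norm_eq_abs]
    nlinarith [sq_nonneg (|normFactor q a b c k| - ‖g k‖), sq_abs (normFactor q a b c k),
      sq_nonneg (|normFactor q a b c k|), sq_nonneg ‖g k‖]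
  -- The induction raises the power of $x$ by the recurrence, for all $m$ at once; this avoids
  -- expanding monomials in the $\beta_m$. The case $m=0$, where $\beta_0=1$, gives the moments.
  have hmom : ∀ j m : ℕ, HasSum (fun k => (normFactor q a b c k : ℂ) * g k *
      ((node q a c k : ℂ) ^ j * (beta q a b c m (node q a c k) : ℂ))) 0 := by
    intro j
    induction j with
    | zero =>
      intro m
      have hS : Summable fun k => (Mhat q a b c m k : ℂ) * g k := by
        refine Summable.of_norm ?_
        refine Summable.of_nonneg_of_le (fun k => norm_nonneg _) (fun k => ?_)
          ((h.hasSum_Mhat_mul m m).summable.add hsq)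
        rw [norm_mul, Complex.norm_real, Real.norm_eq_abs]
        nlinarith [sq_nonneg (|Mhat q a b c m k| - ‖g k‖), abs_mul_abs_self (Mhat q a b c m k),
          sq_nonneg (|Mhat q a b c m k|), sq_nonneg ‖g k‖]
      have h1 := hS.hasSum
      rw [hg] at h1
      refine hasSum_of_eq h1 (fun k => ?_) rfl
      rw [Mhat]
      push_cast
      ring
    | succ j ih =>
      intro m
      rcases m with _ | m
      · have h1 := ((ih 1).mul_left (jacobiOff q a b c 0 : ℂ)).sub
          ((ih 0).mul_left (coeffB q a b c 0 : ℂ))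
        simp only [mul_zero, sub_zero] at h1
        refine hasSum_of_eq h1 (fun k => ?_) rfl
        have h2 : (node q a c k : ℂ) * beta q a b c 0 (node q a c k) =
            jacobiOff q a b c 0 * beta q a b c 1 (node q a c k) -
              coeffB q a b c 0 * beta q a b c 0 (node q a c k) := by
          exact_mod_cast h.mul_beta_zero (node q a c k)
        linear_combination ((normFactor q a b c k : ℂ) * g k * (node q a c k : ℂ) ^ j) * h2
      · have h1 := (((ih (m + 2)).mul_left (jacobiOff q a b c (m + 1) : ℂ)).add
          ((ih m).mul_left (jacobiOff q a b c m : ℂ))).sub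
          ((ih (m + 1)).mul_left (coeffB q a b c (m + 1) : ℂ))
        simp only [mul_zero, sub_zero, add_zero] at h1
        refine hasSum_of_eq h1 (fun k => ?_) rfl
        have h2 : (node q a c k : ℂ) * beta q a b c (m + 1) (node q a c k) =
            jacobiOff q a b c (m + 1) * beta q a b c (m + 2) (node q a c k) +
              jacobiOff q a b c m * beta q a b c m (node q a c k) -
              coeffB q a b c (m + 1) * beta q a b c (m + 1) (node q a c k) := by
          exact_mod_cast h.mul_beta_succ m (node q a c k)
        linear_combination ((normFactor q a b c k : ℂ) * g k * (node q a c k : ℂ) ^ j) * h2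
  have hzero := eq_zero_of_moments hν h.node_injective
    (node_mem h.q_pos h.q_lt h.a_pos h.c_neg) fun j => by
      have h1 := (hmom j 0).tsum_eq
      have h0 (x : ℝ) : beta q a b c 0 x = 1 := by
        rw [h.beta_eq, jacobiNorm_zero, bigQJacobi_zero h.q_pos]; simp
      simpa [h0] using h1
  refine lp.ext (funext fun k => ?_)
  exact (mul_eq_zero.mp (hzero k)).resolve_left
    (Complex.ofReal_ne_zero.mpr (h.normFactor_pos k).ne')

/-- The columns of the matrix `Mhat` form a Hilbert basis. -/
theorem exists_hilbertBasis : ∃ Ψ : HilbertBasis (ℕ ⊕ ℕ) ℂ HilbertSp,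
    ∀ k m, Ψ k m = (Mhat q a b c m k : ℂ) := by
  classical
  choose v hv using h.exists_row
  have hin (m : ℕ) (g : lp (fun _ : ℕ ⊕ ℕ => ℂ) 2) :
      inner ℂ (v m) g = ∑' k, (Mhat q a b c m k : ℂ) * g k := by
    rw [lp.inner_eq_tsum]
    refine tsum_congr fun k => ?_
    rw [hv, RCLike.inner_apply, Complex.conj_ofReal, mul_comm]
  have hon : Orthonormal ℂ v := by
    rw [orthonormal_iff_ite]
    intro m m'
    rw [hin]
    simp only [hv, ← Complex.ofReal_mul]
    rw [← Complex.ofReal_tsum, (h.hasSum_Mhat_mul m m').tsum_eq]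
    split_ifs <;> simp
  have hbot : (Submodule.span ℂ (Set.range v))ᗮ = ⊥ := by
    rw [eq_bot_iff]
    intro g hg
    rw [Submodule.mem_orthogonal] at hg
    refine h.eq_zero_of_orthogonal fun m => ?_
    rw [← hin]
    exact hg _ (Submodule.subset_span ⟨m, rfl⟩)
  let V := HilbertBasis.mkOfOrthogonalEqBot hon hbot
  -- The rows give a unitary map from $\ell^2$ of the nodes onto $\mathcal H_l$. Its inverse serves
  -- as the coordinate map of a basis of $\mathcal H_l$, whose vectors are the images of the unit
  -- vectors, that is, the columns. Column orthogonality thus needs no computation.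
  refine ⟨HilbertBasis.ofRepr V.repr.symm, fun k m => ?_⟩
  rw [← HilbertBasis.repr_symm_single]
  change V.repr (lp.single 2 k 1) m = _
  rw [V.repr_apply_apply, HilbertBasis.coe_mkOfOrthogonalEqBot, lp.inner_single_right, hv]
  simp

end Params

end BigQJacobi
end

noncomputable section

namespace BigQJacobi

open Filter Topology

variable {q a b c l : ℝ}

/-! ### The operator `I₂` on polynomials -/

theorem basis_constr_monomial {M : Type*} [AddCommGroup M] [Module ℂ M] (f : ℕ → M) (n : ℕ)
    (t : ℂ) : (Polynomial.basisMonomials ℂ).constr ℂ f (Polynomial.monomial n t) = t • f n := by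
  have h1 : Polynomial.monomial n t = t • Polynomial.basisMonomials ℂ n := by
    rw [Polynomial.coe_basisMonomials, Polynomial.smul_monomial, smul_eq_mul, mul_one]
  rw [h1, map_smul, Module.Basis.constr_basis]

theorem diagOp_monomial (φ : ℕ → ℝ) (n : ℕ) (t : ℂ) :
    diagOp φ (Polynomial.monomial n t) = Polynomial.monomial n (t * φ n) := by
  rw [diagOp, basis_constr_monomial, Polynomial.smul_monomial, smul_eq_mul]

theorem qJ4_monomial (n : ℕ) (t : ℂ) :
    qJ4 q l (Polynomial.monomial n t) =
      Polynomial.monomial n (t * (q ^ ((l + n) / 4) : ℝ)) := diagOp_monomial _ n t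

theorem Jplus_monomial (n : ℕ) (t : ℂ) :
    Jplus q l (Polynomial.monomial n t) =
      Polynomial.monomial (n + 1) (t * qNumber q (2 * l + n)) := by
  rw [Jplus, basis_constr_monomial, Polynomial.smul_monomial, smul_eq_mul]

theorem Jminus_monomial (n : ℕ) (t : ℂ) :
    Jminus q (Polynomial.monomial n t) = Polynomial.monomial (n - 1) (t * qNumber q n) := by
  rw [Jminus, basis_constr_monomial, Polynomial.smul_monomial, smul_eq_mul]

theorem toHilbert_monomial (n : ℕ) (t : ℂ) :
    toHilbert q l (Polynomial.monomial n t) = (t * (basisConst q l n : ℂ)⁻¹) • basisVec n := by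
  rw [toHilbert, basis_constr_monomial, smul_smul]

/-- The scalar factor of the matrix elements of `I₂` between `xⁿ` and `xⁿ⁺¹`. -/
def matrixFactor (q l b c : ℝ) (n : ℕ) : ℝ :=
  Real.sqrt (-q ^ (2 * l - 1) * c / q) * (1 - q) *
    (q ^ ((l + n) / 4) * q ^ ((l + (n + 1)) / 4) * coeffA q (q ^ (2 * l - 1)) b c n)

theorem I2_monomial_zero (b c : ℝ) :
    I2 q l b c (Polynomial.monomial 0 1) =
      Polynomial.monomial 1 ((matrixFactor q l b c 0 * qNumber q (2 * l + (0 : ℕ)) : ℝ) : ℂ) -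
        Polynomial.monomial 0 (coeffB q (q ^ (2 * l - 1)) b c 0 : ℂ) := by
  -- Truncated subtraction makes `Jminus` send $x^0$ to degree $0$; the coefficient $[0]_q=0$
  -- removes this term.
  have h0 : qNumber q ((0 : ℕ) : ℝ) = 0 := by simp [qNumber]
  simp only [I2, LinearMap.sub_apply, LinearMap.smul_apply, LinearMap.comp_apply,
    LinearMap.add_apply, qJ4_monomial, diagOp_monomial, Jplus_monomial, Jminus_monomial, h0,
    Polynomial.smul_monomial, map_add, smul_eq_mul, smul_add]
  simp only [Complex.ofReal_zero, mul_zero, zero_mul, Polynomial.monomial_zero_right, add_zero,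
    matrixFactor, one_mul, zero_add]
  congr 2
  push_cast
  ring_nf

theorem I2_monomial_succ (b c : ℝ) (n : ℕ) :
    I2 q l b c (Polynomial.monomial (n + 1) 1) =
      Polynomial.monomial (n + 2)
          ((matrixFactor q l b c (n + 1) * qNumber q (2 * l + (n + 1 : ℕ)) : ℝ) : ℂ) +
        Polynomial.monomial n ((matrixFactor q l b c n * qNumber q (n + 1 : ℕ) : ℝ) : ℂ) -
        Polynomial.monomial (n + 1) (coeffB q (q ^ (2 * l - 1)) b c (n + 1) : ℂ) := by
  simp only [I2, LinearMap.sub_apply, LinearMap.smul_apply, LinearMap.comp_apply,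
    LinearMap.add_apply, qJ4_monomial, diagOp_monomial, Jplus_monomial, Jminus_monomial,
    Polynomial.smul_monomial, map_add, smul_eq_mul, smul_add, Nat.add_sub_cancel, matrixFactor,
    one_mul]
  congr 2
  · congr 1
    push_cast
    ring
  · congr 1
    push_cast
    ring

theorem qNumber_eq (hq0 : 0 < q) (hq1 : q < 1) (t : ℝ) :
    qNumber q t = q ^ ((1 - t) / 2) * (1 - q ^ t) / (1 - q) := by
  have e1 : q ^ (t / 2) = q ^ (-t / 2) * q ^ t := by
    rw [← Real.rpow_add hq0]; ring_nf
  have e2 : q ^ (1 / 2 : ℝ) = q ^ (-1 / 2 : ℝ) * q := by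
    nth_rewrite 3 [← Real.rpow_one q]
    rw [← Real.rpow_add hq0]; norm_num
  have e3 : q ^ (-t / 2) = q ^ ((1 - t) / 2) * q ^ (-1 / 2 : ℝ) := by
    rw [← Real.rpow_add hq0]; ring_nf
  have h1 : q ^ (-1 / 2 : ℝ) ≠ 0 := (Real.rpow_pos_of_pos hq0 _).ne'
  have h2 : 1 - q ≠ 0 := by linarith
  have h3 : q - 1 ≠ 0 := by linarith
  rw [qNumber, e1, e2, e3]
  have h4 : q ^ (-1 / 2 : ℝ) * q - q ^ (-1 / 2 : ℝ) = -(q ^ (-1 / 2 : ℝ) * (1 - q)) := by ring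
  rw [h4]
  generalize q ^ (-1 / 2 : ℝ) = s at *
  field_simp
  ring

theorem qNumber_pos (hq0 : 0 < q) (hq1 : q < 1) {t : ℝ} (ht : 0 < t) : 0 < qNumber q t := by
  rw [qNumber_eq hq0 hq1]
  exact div_pos (mul_pos (Real.rpow_pos_of_pos hq0 _)
    (sub_pos.mpr (Real.rpow_lt_one hq0.le hq1 ht))) (sub_pos.mpr hq1)

theorem basisConst_pos (hq0 : 0 < q) (hq1 : q < 1) (hl : 0 < l) (n : ℕ) :
    0 < basisConst q l n := by
  refine Finset.prod_pos fun k hk => ?_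
  have hk1 : (1 : ℝ) ≤ k := by exact_mod_cast (Finset.mem_Icc.mp hk).1
  exact div_pos (Real.sqrt_pos.mpr (qNumber_pos hq0 hq1 (by linarith)))
    (Real.sqrt_pos.mpr (qNumber_pos hq0 hq1 (by linarith)))

theorem basisConst_succ (n : ℕ) :
    basisConst q l (n + 1) = basisConst q l n *
      (Real.sqrt (qNumber q (2 * l + n)) / Real.sqrt (qNumber q (n + 1 : ℕ))) := by
  rw [basisConst, Finset.prod_Icc_succ_top (by lia)]
  congr 4
  push_cast
  ring

/-- Both sides are nonnegative, so their squares are compared. The choice $a=q^{2l-1}$ turns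
$1-q^{2l+n}$ into $1-aq^{n+1}$, and the fractional powers of $q$ collapse to a single $q$,
cancelling the one in $\alpha^2$. -/
theorem matrixFactor_mul_sqrt (h : Params q a b c) (hl : 0 < l) (ha : a = q ^ (2 * l - 1))
    (n : ℕ) :
    matrixFactor q l b c n * Real.sqrt (qNumber q (2 * l + n)) *
      Real.sqrt (qNumber q (n + 1 : ℕ)) = jacobiOff q a b c n := by
  have hq0 := h.q_pos
  have hq1 := h.q_lt
  have hn : (0 : ℝ) ≤ n := n.cast_nonneg
  have hN1 := qNumber_pos hq0 hq1 (t := 2 * l + n) (by linarith)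
  have hN2 := qNumber_pos hq0 hq1 (t := ((n + 1 : ℕ) : ℝ)) (by push_cast; linarith)
  have hX := sub_pos.mpr (h.ab_mul_pow_lt (2 * n))
  have hα : 0 ≤ -a * c / q := (div_pos h.neg_ac_pos hq0).le
  have hA0 : 0 ≤ coeffA q a b c n := div_nonneg (mul_nonneg (Real.rpow_pos_of_pos hq0 _).le
    (Real.sqrt_nonneg _)) hX.le
  have hR : 0 ≤ (1 - b * q ^ (n + 1)) * (1 - c * q ^ (n + 1)) * (1 - a * b / c * q ^ (n + 1)) *
      abRatio q a b n / (1 - a * b * q ^ (2 * n + 3)) :=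
    (div_pos (mul_pos (mul_pos (mul_pos (sub_pos.mpr (h.b_mul_pow_lt n)) (h.one_sub_c_pos _))
      (h.one_sub_ab_div_c_pos _)) (h.abRatio_pos n))
      (sub_pos.mpr (h.ab_mul_pow_lt (2 * n + 1)))).le
  have hE := (Real.rpow_pos_of_pos hq0 ((l + n) / 4)).le
  have hE' := (Real.rpow_pos_of_pos hq0 ((l + (n + 1)) / 4)).le
  have hq1' : 0 < 1 - q := sub_pos.mpr hq1
  unfold matrixFactor
  rw [← ha]
  rw [← sq_eq_sq₀ (by positivity) (h.jacobiOff_pos n).le, h.jacobiOff_sq, recUp, recDown_succ]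
  simp only [mul_pow]
  rw [Real.sq_sqrt hN1.le, Real.sq_sqrt hN2.le, Real.sq_sqrt hα, coeffA, div_pow, mul_pow,
    Real.sq_sqrt hR, qNumber_eq hq0 hq1, qNumber_eq hq0 hq1]
  have r1 : (q ^ (((n : ℝ) + 2) / 2)) ^ 2 = q ^ (n + 2) := by
    rw [← Real.rpow_natCast, ← Real.rpow_mul hq0.le, ← Real.rpow_natCast]
    push_cast
    ring_nf
  have r2 : q ^ (2 * l + n) = a * q ^ (n + 1) := by
    rw [ha, ← Real.rpow_natCast q (n + 1), ← Real.rpow_add hq0]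
    push_cast
    ring_nf
  have r3 : q ^ (((n + 1 : ℕ) : ℝ)) = q ^ (n + 1) := Real.rpow_natCast q (n + 1)
  have r4 : (q ^ ((l + n) / 4)) ^ 2 * (q ^ ((l + (n + 1)) / 4)) ^ 2 *
      (q ^ ((1 - (2 * l + n)) / 2) * q ^ ((1 - ((n + 1 : ℕ) : ℝ)) / 2)) = q := by
    rw [← Real.rpow_natCast, ← Real.rpow_natCast, ← Real.rpow_mul hq0.le, ← Real.rpow_mul hq0.le,
      ← Real.rpow_add hq0, ← Real.rpow_add hq0, ← Real.rpow_add hq0]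
    conv_rhs => rw [← Real.rpow_one q]
    congr 1
    push_cast
    ring
  rw [r1, r2, r3]
  have hq := hq0.ne'
  have hc := hq1'.ne'
  calc _ = (q⁻¹ * ((q ^ ((l + n) / 4)) ^ 2 * (q ^ ((l + (n + 1)) / 4)) ^ 2 *
      (q ^ ((1 - (2 * l + n)) / 2) * q ^ ((1 - ((n + 1 : ℕ) : ℝ)) / 2)))) *
      ((1 - q) / (1 - q)) ^ 2 * ((1 - a * q ^ (n + 1)) * (1 - c * q ^ (n + 1)) *
      abRatio q a b n / (1 - a * b * q ^ (2 * n + 2)) *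
      (-a * c * q ^ (n + 2) * ((1 - q ^ (n + 1)) * (1 - b * q ^ (n + 1)) *
      (1 - a * b / c * q ^ (n + 1)) /
      ((1 - a * b * q ^ (2 * n + 2)) * (1 - a * b * q ^ (2 * n + 3)))))) := by
        clear r1 r2 r3 r4
        generalize 1 - a * b * q ^ (2 * n + 2) = X at *
        generalize 1 - a * b * q ^ (2 * n + 3) = Y at *
        generalize 1 - a * q ^ (n + 1) = Z at *
        generalize 1 - c * q ^ (n + 1) = W at *
        generalize 1 - a * b / c * q ^ (n + 1) = U at *
        generalize 1 - b * q ^ (n + 1) = V at *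
        generalize 1 - q ^ (n + 1) = S at *
        generalize 1 - q = T at *
        generalize q ^ ((l + n) / 4) = e1 at *
        generalize q ^ ((l + (n + 1)) / 4) = e2 at *
        generalize q ^ ((1 - (2 * l + n)) / 2) = e3 at *
        generalize q ^ ((1 - ((n + 1 : ℕ) : ℝ)) / 2) = e4 at *
        ring
    _ = _ := by rw [r4, inv_mul_cancel₀ hq, div_self hc, one_pow, one_mul, one_mul]

/-- The matrix element of `I₂` from `f_n` to `f_{n+1}`. -/
theorem matrixFactor_up (h : Params q a b c) (hl : 0 < l) (ha : a = q ^ (2 * l - 1)) (n : ℕ) :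
    matrixFactor q l b c n * qNumber q (2 * l + n) * (basisConst q l (n + 1))⁻¹ =
      (basisConst q l n)⁻¹ * jacobiOff q a b c n := by
  have hn : (0 : ℝ) ≤ n := n.cast_nonneg
  have h1 := qNumber_pos h.q_pos h.q_lt (t := 2 * l + n) (by linarith)
  have h2 := qNumber_pos h.q_pos h.q_lt (t := ((n + 1 : ℕ) : ℝ)) (by push_cast; linarith)
  have h3 := (basisConst_pos h.q_pos h.q_lt hl n).ne'
  have s1 := (Real.sqrt_pos.mpr h1).ne'
  have s2 := (Real.sqrt_pos.mpr h2).ne'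
  rw [← matrixFactor_mul_sqrt h hl ha, basisConst_succ]
  nth_rewrite 1 [← Real.mul_self_sqrt h1.le]
  generalize Real.sqrt (qNumber q (2 * l + n)) = u at *
  generalize Real.sqrt (qNumber q (n + 1 : ℕ)) = v at *
  field_simp

/-- The matrix element of `I₂` from `f_{n+1}` to `f_n`. -/
theorem matrixFactor_down (h : Params q a b c) (hl : 0 < l) (ha : a = q ^ (2 * l - 1)) (n : ℕ) :
    matrixFactor q l b c n * qNumber q (n + 1 : ℕ) * (basisConst q l n)⁻¹ =
      (basisConst q l (n + 1))⁻¹ * jacobiOff q a b c n := by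
  have hn : (0 : ℝ) ≤ n := n.cast_nonneg
  have h1 := qNumber_pos h.q_pos h.q_lt (t := 2 * l + n) (by linarith)
  have h2 := qNumber_pos h.q_pos h.q_lt (t := ((n + 1 : ℕ) : ℝ)) (by push_cast; linarith)
  have h3 := (basisConst_pos h.q_pos h.q_lt hl n).ne'
  have s1 := (Real.sqrt_pos.mpr h1).ne'
  have s2 := (Real.sqrt_pos.mpr h2).ne'
  rw [← matrixFactor_mul_sqrt h hl ha, basisConst_succ]
  nth_rewrite 1 [← Real.mul_self_sqrt h2.le]
  generalize Real.sqrt (qNumber q (2 * l + n)) = u at *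
  generalize Real.sqrt (qNumber q (n + 1 : ℕ)) = v at *
  field_simp

/-- A bounded operator that acts on the basis vectors as the Jacobi matrix extends `I₂`. -/
theorem extends_of_jacobi (h : Params q a b c) (hl : 0 < l) (ha : a = q ^ (2 * l - 1))
    {T : HilbertSp →L[ℂ] HilbertSp}
    (h0 : T (basisVec 0) = (jacobiOff q a b c 0 : ℂ) • basisVec 1 -
      (coeffB q a b c 0 : ℂ) • basisVec 0)
    (h1 : ∀ n, T (basisVec (n + 1)) = (jacobiOff q a b c (n + 1) : ℂ) • basisVec (n + 2) +
      (jacobiOff q a b c n : ℂ) • basisVec n - (coeffB q a b c (n + 1) : ℂ) • basisVec (n + 1)) :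
    Extends q l T (I2 q l b c) := by
  have key : (T : HilbertSp →ₗ[ℂ] HilbertSp) ∘ₗ toHilbert q l =
      toHilbert q l ∘ₗ I2 q l b c := by
    refine (Polynomial.basisMonomials ℂ).ext fun n => ?_
    rw [Polynomial.coe_basisMonomials, LinearMap.comp_apply, LinearMap.comp_apply,
      toHilbert_monomial, one_mul, map_smul, ContinuousLinearMap.coe_coe]
    have up (n : ℕ) := congrArg (fun x : ℝ => (x : ℂ)) (matrixFactor_up h hl ha n)
    have down (n : ℕ) := congrArg (fun x : ℝ => (x : ℂ)) (matrixFactor_down h hl ha n)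
    simp only [Complex.ofReal_mul, Complex.ofReal_inv] at up down
    rcases n with _ | n
    · rw [I2_monomial_zero, map_sub, toHilbert_monomial, toHilbert_monomial, h0,
        Complex.ofReal_mul, up 0, ← ha]
      module
    · rw [I2_monomial_succ, map_sub, map_add, toHilbert_monomial, toHilbert_monomial,
        toHilbert_monomial, h1, Complex.ofReal_mul, Complex.ofReal_mul, up (n + 1), down n, ← ha]
      module
  exact fun p => LinearMap.congr_fun key p

/-- Each $f_n$ is the image of a multiple of a monomial, and a bounded operator is determined by its
values on the $f_n$. -/
theorem extends_unique (hq0 : 0 < q) (hq1 : q < 1) (hl : 0 < l)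
    {T T' : HilbertSp →L[ℂ] HilbertSp} {S : Polynomial ℂ →ₗ[ℂ] Polynomial ℂ}
    (hT : Extends q l T S) (hT' : Extends q l T' S) : T' = T := by
  refine lp.ext_continuousLinearMap (by simp) fun n => ?_
  ext
  have h1 : (basisVec n : HilbertSp) =
      toHilbert q l (Polynomial.monomial n (basisConst q l n : ℂ)) := by
    rw [toHilbert_monomial, mul_inv_cancel₀, one_smul]
    exact Complex.ofReal_ne_zero.mpr (basisConst_pos hq0 hq1 hl n).ne'
  have h2 : T' (basisVec n) = T (basisVec n) := by rw [h1, hT, hT']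
  have h3 := congrArg (fun v : HilbertSp => v) h2
  simp only [basisVec] at h3
  simp [h3]

end BigQJacobi
end

noncomputable section

namespace BigQJacobi

open Filter Topology

variable {q a b c : ℝ}

/-! ### Diagonalization of `I₂` -/

theorem repr_basisVec {Ψ : HilbertBasis (ℕ ⊕ ℕ) ℂ HilbertSp}
    (hΨ : ∀ k m, Ψ k m = (Mhat q a b c m k : ℂ)) (m : ℕ) (k : ℕ ⊕ ℕ) :
    Ψ.repr (basisVec m) k = (Mhat q a b c m k : ℂ) := by
  rw [Ψ.repr_apply_apply, basisVec, lp.inner_single_right, hΨ]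
  simp

theorem hasSum_column_mul {Ψ : HilbertBasis (ℕ ⊕ ℕ) ℂ HilbertSp}
    (hΨ : ∀ k m, Ψ k m = (Mhat q a b c m k : ℂ)) (k k' : ℕ ⊕ ℕ) :
    HasSum (fun m => Mhat q a b c m k * Mhat q a b c m k') (if k = k' then 1 else 0) := by
  have h1 := lp.hasSum_inner (𝕜 := ℂ) (Ψ k) (Ψ k')
  rw [orthonormal_iff_ite.mp Ψ.orthonormal] at h1
  rw [← Complex.hasSum_ofReal]
  refine hasSum_of_eq h1 (fun m => ?_) ?_
  · rw [hΨ, hΨ, RCLike.inner_apply, Complex.conj_ofReal]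
    push_cast
    ring
  · split_ifs <;> simp

namespace Params

variable (h : Params q a b c)
include h

theorem tendsto_node : Tendsto (fun k => (node q a c k : ℂ)) cofinite (𝓝 0) := by
  have h1 := (summable_abs_node h.q_pos h.q_lt (a := a) (c := c)).of_abs.tendsto_cofinite_zero
  have h2 := (Complex.continuous_ofReal.tendsto 0).comp h1
  rw [Complex.ofReal_zero] at h2
  exact h2

/-- The $\Psi$-coordinates of $f_m$ form row $m$ of `Mhat`, and $T$ multiplies them by the nodes.
The claim is the recurrence for $\beta$ read at each node. -/
theorem isDiagonal_basisVec_zero {Ψ : HilbertBasis (ℕ ⊕ ℕ) ℂ HilbertSp}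
    (hΨ : ∀ k m, Ψ k m = (Mhat q a b c m k : ℂ)) {T : HilbertSp →L[ℂ] HilbertSp}
    (hT : IsDiagonal Ψ T fun k => (node q a c k : ℂ)) :
    T (basisVec 0) = (jacobiOff q a b c 0 : ℂ) • basisVec 1 -
      (coeffB q a b c 0 : ℂ) • basisVec 0 := by
  refine repr_ext Ψ fun k => ?_
  rw [hT, map_sub, map_smul, map_smul, lp.coeFn_sub, Pi.sub_apply, lp.coeFn_smul, lp.coeFn_smul,
    Pi.smul_apply, Pi.smul_apply, repr_basisVec hΨ, repr_basisVec hΨ, smul_eq_mul, smul_eq_mul]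
  have key : (node q a c k : ℂ) * (beta q a b c 0 (node q a c k) : ℂ) =
      jacobiOff q a b c 0 * beta q a b c 1 (node q a c k) -
        coeffB q a b c 0 * beta q a b c 0 (node q a c k) := by
    exact_mod_cast h.mul_beta_zero (node q a c k)
  simp only [Mhat, Complex.ofReal_mul]
  linear_combination (normFactor q a b c k : ℂ) * key

theorem isDiagonal_basisVec_succ {Ψ : HilbertBasis (ℕ ⊕ ℕ) ℂ HilbertSp}
    (hΨ : ∀ k m, Ψ k m = (Mhat q a b c m k : ℂ)) {T : HilbertSp →L[ℂ] HilbertSp}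
    (hT : IsDiagonal Ψ T fun k => (node q a c k : ℂ)) (n : ℕ) :
    T (basisVec (n + 1)) = (jacobiOff q a b c (n + 1) : ℂ) • basisVec (n + 2) +
      (jacobiOff q a b c n : ℂ) • basisVec n -
      (coeffB q a b c (n + 1) : ℂ) • basisVec (n + 1) := by
  refine repr_ext Ψ fun k => ?_
  rw [hT, map_sub, map_add, map_smul, map_smul, map_smul, lp.coeFn_sub, Pi.sub_apply, lp.coeFn_add,
    Pi.add_apply, lp.coeFn_smul, lp.coeFn_smul, lp.coeFn_smul, Pi.smul_apply, Pi.smul_apply,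
    Pi.smul_apply, repr_basisVec hΨ, repr_basisVec hΨ, repr_basisVec hΨ, smul_eq_mul,
    smul_eq_mul, smul_eq_mul]
  have key : (node q a c k : ℂ) * (beta q a b c (n + 1) (node q a c k) : ℂ) =
      jacobiOff q a b c (n + 1) * beta q a b c (n + 2) (node q a c k) +
        jacobiOff q a b c n * beta q a b c n (node q a c k) -
        coeffB q a b c (n + 1) * beta q a b c (n + 1) (node q a c k) := by
    exact_mod_cast h.mul_beta_succ n (node q a c k)
  simp only [Mhat, Complex.ofReal_mul]
  linear_combination (normFactor q a b c k : ℂ) * key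

theorem abs_node_le (k : ℕ ⊕ ℕ) : |node q a c k| ≤ max |c * q| |a * q| :=
  abs_le_max_abs_abs (node_mem h.q_pos h.q_lt h.a_pos h.c_neg k).1
    (node_mem h.q_pos h.q_lt h.a_pos h.c_neg k).2

theorem isTraceClass {Ψ : HilbertBasis (ℕ ⊕ ℕ) ℂ HilbertSp} {T : HilbertSp →L[ℂ] HilbertSp}
    (hT : IsDiagonal Ψ T fun k => (node q a c k : ℂ)) : IsTraceClass T := by
  -- The operator $|T|$ is diagonal with entries $|x_k|$, and its trace in the basis $\Psi$,
  -- reindexed by $\mathbb N$, is the sum of two geometric series.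
  obtain ⟨R, hR⟩ := exists_isDiagonal Ψ (z := fun k => ((|node q a c k| : ℝ) : ℂ))
    (C := max |c * q| |a * q|) fun k => by
      rw [Complex.norm_real, Real.norm_eq_abs, abs_abs]; exact h.abs_node_le k
  obtain ⟨e, he⟩ := exists_hilbertBasis_comp Ψ Equiv.natSumNatEquivNat.symm
  refine ⟨R, hR.isPositive fun k => abs_nonneg _, ?_, e, ?_⟩
  · rw [hT.isSelfAdjoint.adjoint_eq]
    have hz : (fun k => ((|node q a c k| : ℝ) : ℂ) * ((|node q a c k| : ℝ) : ℂ)) =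
        fun k => (node q a c k : ℂ) * (node q a c k : ℂ) := funext fun k => by
      rw [← Complex.ofReal_mul, abs_mul_abs_self, Complex.ofReal_mul]
    have hRR := hR.mul hR
    rw [hz] at hRR
    exact hRR.unique (hT.mul hT)
  · have h1 := (summable_abs_node h.q_pos h.q_lt (a := a) (c := c)).comp_injective
      Equiv.natSumNatEquivNat.symm.injective
    refine h1.congr fun n => ?_
    rw [he, hR.apply_basis, inner_smul_right, inner_self_eq_norm_sq_to_K, Ψ.orthonormal.1]
    simp

theorem eigenspace_eq_span {Ψ : HilbertBasis (ℕ ⊕ ℕ) ℂ HilbertSp}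
    (hΨ : ∀ k m, Ψ k m = (Mhat q a b c m k : ℂ)) {T : HilbertSp →L[ℂ] HilbertSp}
    (hT : IsDiagonal Ψ T fun k => (node q a c k : ℂ)) (k : ℕ ⊕ ℕ) :
    ∃ ψ : HilbertSp, (∀ m, ψ m = (beta q a b c m (node q a c k) : ℂ)) ∧ ψ ≠ 0 ∧
      Module.End.eigenspace (T : Module.End ℂ HilbertSp) (node q a c k : ℂ) =
        Submodule.span ℂ {ψ} := by
  have hn : (normFactor q a b c k : ℂ) ≠ 0 := Complex.ofReal_ne_zero.mpr (h.normFactor_pos k).ne'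
  refine ⟨(normFactor q a b c k : ℂ)⁻¹ • Ψ k, fun m => ?_,
    smul_ne_zero (inv_ne_zero hn) (Ψ.orthonormal.ne_zero k), ?_⟩
  · rw [lp.coeFn_smul, Pi.smul_apply, hΨ, Mhat, smul_eq_mul, Complex.ofReal_mul,
      inv_mul_cancel_left₀ hn]
  · rw [Submodule.span_singleton_smul_eq (inv_ne_zero hn).isUnit]
    exact hT.eigenspace_eq (Complex.ofReal_injective.comp h.node_injective) k

theorem orthogonality_relation (m m' : ℕ) :
    Summable (fun n : ℕ => weight q a b c n * bigQJacobi q a b c m (a * q ^ (n + 1)) *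
      bigQJacobi q a b c m' (a * q ^ (n + 1))) ∧
    Summable (fun n : ℕ => weight' q a b c n * bigQJacobi q a b c m (c * q ^ (n + 1)) *
      bigQJacobi q a b c m' (c * q ^ (n + 1))) ∧
    constC q a b c * (∑' n : ℕ, weight q a b c n * bigQJacobi q a b c m (a * q ^ (n + 1)) *
        bigQJacobi q a b c m' (a * q ^ (n + 1))) +
      constC' q a b c * (∑' n : ℕ, weight' q a b c n * bigQJacobi q a b c m (c * q ^ (n + 1)) *
        bigQJacobi q a b c m' (c * q ^ (n + 1))) =
    if m = m' then jacobiNorm q a b c m else 0 := by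
  have hS := h.hasSum_bigQJacobi_mul m m'
  have el (n : ℕ) : normFactor q a b c (Sum.inl n) ^ 2 *
      (bigQJacobi q a b c m (node q a c (Sum.inl n)) *
        bigQJacobi q a b c m' (node q a c (Sum.inl n))) =
      constC q a b c * (weight q a b c n * bigQJacobi q a b c m (a * q ^ (n + 1)) *
        bigQJacobi q a b c m' (a * q ^ (n + 1))) := by
    rw [h.normFactor_sq_inl]
    simp only [node, Sum.elim_inl]
    ring
  have er (n : ℕ) : normFactor q a b c (Sum.inr n) ^ 2 *
      (bigQJacobi q a b c m (node q a c (Sum.inr n)) *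
        bigQJacobi q a b c m' (node q a c (Sum.inr n))) =
      constC' q a b c * (weight' q a b c n * bigQJacobi q a b c m (c * q ^ (n + 1)) *
        bigQJacobi q a b c m' (c * q ^ (n + 1))) := by
    rw [h.normFactor_sq_inr]
    simp only [node, Sum.elim_inr]
    ring
  have Sl := hS.summable.comp_injective Sum.inl_injective
  have Sr := hS.summable.comp_injective Sum.inr_injective
  have hE := hS.tsum_eq
  rw [Summable.tsum_sum Sl Sr, tsum_congr el, tsum_congr er, tsum_mul_left, tsum_mul_left] at hE
  exact ⟨(summable_mul_left_iff h.constC_pos.ne').mp (Sl.congr el),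
    (summable_mul_left_iff h.constC'_pos.ne').mp (Sr.congr er), hE⟩

end Params

end BigQJacobi
end

/-! ### The main theorem. -/

theorem mainTheorem7 (q l a b c : ℝ) (hq0 : 0 < q) (hq1 : q < 1) (hl : 0 < l)
    (ha : a = q ^ (2 * l - 1)) (hb0 : 0 < b) (hb1 : b < q⁻¹) (hc : c < 0) :
    -- `I₂` has a unique bounded extension `T` to the Hilbert space
    ∃ T : BigQJacobi.HilbertSp →L[ℂ] BigQJacobi.HilbertSp,
      BigQJacobi.Extends q l T (BigQJacobi.I2 q l b c) ∧
      (∀ T' : BigQJacobi.HilbertSp →L[ℂ] BigQJacobi.HilbertSp,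
        BigQJacobi.Extends q l T' (BigQJacobi.I2 q l b c) → T' = T) ∧
      IsSelfAdjoint T ∧
      BigQJacobi.IsTraceClass T ∧
      -- it is a Jacobi operator
      (∀ n : ℕ, 0 < BigQJacobi.jacobiOff q a b c n) ∧
      T (BigQJacobi.basisVec 0) =
        (BigQJacobi.jacobiOff q a b c 0 : ℂ) • BigQJacobi.basisVec 1 -
          (BigQJacobi.coeffB q a b c 0 : ℂ) • BigQJacobi.basisVec 0 ∧
      (∀ n : ℕ, T (BigQJacobi.basisVec (n + 1)) =
        (BigQJacobi.jacobiOff q a b c (n + 1) : ℂ) • BigQJacobi.basisVec (n + 2) +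
          (BigQJacobi.jacobiOff q a b c n : ℂ) • BigQJacobi.basisVec n -
          (BigQJacobi.coeffB q a b c (n + 1) : ℂ) • BigQJacobi.basisVec (n + 1)) ∧
      -- the spectrum, its accumulation point, and the eigenvalues
      spectrum ℂ T =
        insert 0 (Set.range fun k : ℕ ⊕ ℕ => (BigQJacobi.node q a c k : ℂ)) ∧
      (∀ z : ℂ, AccPt z (Filter.principal (spectrum ℂ T)) ↔ z = 0) ∧
      (∀ z : ℂ, Module.End.HasEigenvalue (T : Module.End ℂ BigQJacobi.HilbertSp) z ↔
        ∃ k : ℕ ⊕ ℕ, z = (BigQJacobi.node q a c k : ℂ)) ∧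
      Function.Injective (BigQJacobi.node q a c) ∧
      -- simplicity, and the eigenvectors in terms of big `q`-Jacobi polynomials
      (∀ k : ℕ ⊕ ℕ, ∃ ψ : BigQJacobi.HilbertSp,
        (∀ m : ℕ, ψ m = (BigQJacobi.beta q a b c m (BigQJacobi.node q a c k) : ℂ)) ∧
        ψ ≠ 0 ∧
        Module.End.eigenspace (T : Module.End ℂ BigQJacobi.HilbertSp)
          (BigQJacobi.node q a c k : ℂ) = Submodule.span ℂ {ψ}) ∧
      -- the normalized eigenvectors form an orthonormal basis
      (∃ Ψ : HilbertBasis (ℕ ⊕ ℕ) ℂ BigQJacobi.HilbertSp,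
        (∀ (k : ℕ ⊕ ℕ) (m : ℕ), (Ψ k) m = (BigQJacobi.Mhat q a b c m k : ℂ)) ∧
        ∀ k : ℕ ⊕ ℕ, T (Ψ k) = (BigQJacobi.node q a c k : ℂ) • Ψ k) ∧
      -- the transition matrix is orthogonal
      (∀ k k' : ℕ ⊕ ℕ,
        HasSum (fun m : ℕ => BigQJacobi.Mhat q a b c m k * BigQJacobi.Mhat q a b c m k')
          (if k = k' then 1 else 0)) ∧
      (∀ m m' : ℕ,
        HasSum (fun k : ℕ ⊕ ℕ => BigQJacobi.Mhat q a b c m k * BigQJacobi.Mhat q a b c m' k)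
          (if m = m' then 1 else 0)) ∧
      -- the orthogonality relation for the big `q`-Jacobi polynomials
      ∀ m m' : ℕ,
        Summable (fun n : ℕ => BigQJacobi.weight q a b c n *
          BigQJacobi.bigQJacobi q a b c m (a * q ^ (n + 1)) *
          BigQJacobi.bigQJacobi q a b c m' (a * q ^ (n + 1))) ∧
        Summable (fun n : ℕ => BigQJacobi.weight' q a b c n *
          BigQJacobi.bigQJacobi q a b c m (c * q ^ (n + 1)) *
          BigQJacobi.bigQJacobi q a b c m' (c * q ^ (n + 1))) ∧
        BigQJacobi.constC q a b c * (∑' n : ℕ, BigQJacobi.weight q a b c n *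
            BigQJacobi.bigQJacobi q a b c m (a * q ^ (n + 1)) *
            BigQJacobi.bigQJacobi q a b c m' (a * q ^ (n + 1))) +
          BigQJacobi.constC' q a b c * (∑' n : ℕ, BigQJacobi.weight' q a b c n *
            BigQJacobi.bigQJacobi q a b c m (c * q ^ (n + 1)) *
            BigQJacobi.bigQJacobi q a b c m' (c * q ^ (n + 1))) =
        if m = m' then
          BigQJacobi.qPoch q (b * q) m * BigQJacobi.qPoch q (a * b * q / c) m *
              BigQJacobi.qPoch q q m /
            (BigQJacobi.abWeight q a b m * BigQJacobi.qPoch q (a * q) m *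
              BigQJacobi.qPoch q (c * q) m) *
            (-a * c) ^ m * q ^ (((m : ℝ) * (m + 3)) / 2)
        else 0 := by 
  have hp : BigQJacobi.Params q a b c :=
    { q_pos := hq0
      q_lt := hq1
      a_pos := ha ▸ Real.rpow_pos_of_pos hq0 _
      aq_lt := by
        -- Here $aq=q^{2l}$, which is below $1$ because $l>0$.
        rw [ha, ← Real.rpow_add_one hq0.ne', sub_add_cancel]
        exact Real.rpow_lt_one hq0.le hq1 (by positivity)
      b_pos := hb0
      bq_lt := (lt_inv_mul_iff₀' hq0).mp (by rwa [mul_one])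
      c_neg := hc }
  obtain ⟨Ψ, hΨ⟩ := hp.exists_hilbertBasis
  obtain ⟨T, hT⟩ := BigQJacobi.exists_isDiagonal Ψ
    (z := fun k => (BigQJacobi.node q a c k : ℂ)) (C := max |c * q| |a * q|) fun k => by
      rw [Complex.norm_real, Real.norm_eq_abs]
      exact hp.abs_node_le k
  have h0 := hp.isDiagonal_basisVec_zero hΨ hT
  have h1 := hp.isDiagonal_basisVec_succ hΨ hT
  have hext := BigQJacobi.extends_of_jacobi hp hl ha h0 h1
  have hsp := hT.spectrum_eq hp.tendsto_node
  refine ⟨T, hext, fun T' hT' => BigQJacobi.extends_unique hq0 hq1 hl hext hT', hT.isSelfAdjoint,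
    hp.isTraceClass hT, hp.jacobiOff_pos, h0, h1, hsp, fun z => ?_,
    fun z => hT.hasEigenvalue_iff, hp.node_injective, hp.eigenspace_eq_span hΨ hT,
    ⟨Ψ, hΨ, hT.apply_basis⟩, BigQJacobi.hasSum_column_mul hΨ, hp.hasSum_Mhat_mul,
    hp.orthogonality_relation⟩
  rw [hsp]
  exact BigQJacobi.accPt_insert_range_iff hp.tendsto_node
    (fun k => Complex.ofReal_ne_zero.mpr (hp.node_ne_zero k)) z
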